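/- Let $n,k,r$ be positive integers and let $\lambda=(\lambda_1\ge\lambda_2\ge\cdots)$ be a partition of $n$, with $\lambda_i=0$ for $i>\ell(\lambda)$. Let $\mathcal P^r(V_{n,k})$ be the space of homogeneous polynomials of degree $r$ over $\mathbb C$ in the variables $x_{ij}$, $1\le i\le n$, $1\le j\le k$, on which the symmetric group $S_n$ acts by permuting the first index, $\sigma\cdot x_{ij}=x_{\sigma(i)j}$. Let $\mathcal A_{r,k}(n)=\operatorname{End}_{\mathbb C S_n}(\mathcal P^r(V_{n,k}))$, let $W^\lambda_{\mathbb C S_n}$ be the irreducible $\mathbb C S_n$-module (Specht module) indexed by $\lambda$, and let $$W^\lambda_{\mathcal A_{r,k}(n)}=\operatorname{Hom}_{\mathbb C S_n}\bigl(W^\lambda_{\mathbb C S_n},\mathcal P^r(V_{n,k})\bigr),$$ on which $\mathcal A_{r,k}(n)$ acts by composition. Let $s_\lambda\in\mathbb Q[p_1,p_2,\dots]$ be the Schur function, written in the power sums $p_m$, and let $s_\lambda\!\left[\frac1{(1-q)^k}\right]\in\mathbb Q[[q]]$ be the series obtained from it by replacing each $p_m$ by $\frac{1}{(1-q^m)^k}$.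 Then $W^\lambda_{\mathcal A_{r,k}(n)}$ is finite-dimensional and $$\dim W^\lambda_{\mathcal A_{r,k}(n)}=\text{coefficient of }q^r\text{ in }s_\lambda\!\left[\frac{1}{(1-q)^k}\right].$$ Moreover, this coefficient is nonzero if and only if $$r\ \ge\ \sum_{j\ge1}(j-1)\sum_{i=t_{j-1}+1}^{t_j}\lambda_i ,\qquad t_d=\sum_{m=0}^{d-1}\binom{k+m-1}{m},$$ and the same inequality holds if and only if $W^\lambda_{\mathcal A_{r,k}(n)}$ is an irreducible (in particular nonzero) $\mathcal A_{r,k}(n)$-module. -/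

import Mathlib

noncomputable section

namespace MultisetPartition

/-! ### Partitions, tableaux and Specht modules -/

/-- The part `lam_i` of a partition (`1`-based, in weakly decreasing order), with the convention
`lam_i = 0` for `i > ℓ(lam)`. -/
def part {n : ℕ} (lam : n.Partition) (i : ℕ) : ℕ :=
  (lam.parts.sort (fun a b => b ≤ a)).getD (i - 1) 0

/-- The cells `(i, j)` of the Young diagram of `lam`: row `i`, column `j`, both counted from `0`. -/
abbrev Cell {n : ℕ} (lam : n.Partition) : Type :=
  {c : ℕ × ℕ // c.2 < part lam (c.1 + 1)}

/-- A (bijective) Young tableau of shape `lam`: it places each `a : Fin n` in a cell. -/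
abbrev Tableau {n : ℕ} (lam : n.Partition) : Type :=
  Fin n ≃ Cell lam

/-- The row of the tableau containing the entry `a`. As a function of `a`, this is exactly
the tabloid (row equivalence class) of the tableau. -/
def Tableau.row {n : ℕ} {lam : n.Partition} (T : Tableau lam) (a : Fin n) : ℕ := (T a).1.1

/-- The column of the tableau containing the entry `a`. -/
def Tableau.col {n : ℕ} {lam : n.Partition} (T : Tableau lam) (a : Fin n) : ℕ := (T a).1.2

/-- The space with basis the assignments of a row to each of the entries `1, …, n`, where the
symmetric group acts by permuting the entries. The tabloids of shape `lam` span a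
subrepresentation of it, the permutation module `M^lam`. -/
def rowRep (n : ℕ) : Representation ℂ (Equiv.Perm (Fin n)) ((Fin n → ℕ) →₀ ℂ) where
  toFun s := Finsupp.lmapDomain ℂ ℂ (fun f => f ∘ ⇑s⁻¹)
  map_one' := by
    refine LinearMap.ext fun v => ?_
    simp [show (fun f : Fin n → ℕ => f) = id from rfl]
  map_mul' s t := by
    refine LinearMap.ext fun v => ?_
    simp only [Module.End.mul_apply, Finsupp.lmapDomain_apply, ← Finsupp.mapDomain_comp]
    rfl

/-- The polytabloid `e_T = ∑_s sgn(s) s{T}`, over the permutations `s` preserving the columns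
of `T`. -/
def polytabloid {n : ℕ} {lam : n.Partition} (T : Tableau lam) : (Fin n → ℕ) →₀ ℂ :=
  ∑ s : Equiv.Perm (Fin n) with (∀ a, T.col (s a) = T.col a),
    ((Equiv.Perm.sign s : ℤ) : ℂ) • rowRep n s (Finsupp.single T.row 1)

/-- The symmetric group maps polytabloids to polytabloids. -/
theorem rowRep_polytabloid {n : ℕ} {lam : n.Partition} (T : Tableau lam)
    (s : Equiv.Perm (Fin n)) :
    rowRep n s (polytabloid T) = polytabloid (s.symm.trans T : Tableau lam) := by
  have hrow : Finsupp.single (Tableau.row (s.symm.trans T : Tableau lam)) (1 : ℂ)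
      = rowRep n s (Finsupp.single T.row 1) := by
    simp only [rowRep, MonoidHom.coe_mk, OneHom.coe_mk, Finsupp.lmapDomain_apply,
      Finsupp.mapDomain_single]
    rfl
  unfold polytabloid
  rw [hrow, map_sum]
  refine Finset.sum_bij' (fun t _ => s * t * s⁻¹) (fun t _ => s⁻¹ * t * s) ?_ ?_ ?_ ?_ ?_
  · intro t ht
    simp only [Finset.mem_filter, Finset.mem_univ, true_and] at ht ⊢
    intro a
    have := ht (s⁻¹ a)
    simpa [Tableau.col] using this
  · intro t ht
    simp only [Finset.mem_filter, Finset.mem_univ, true_and] at ht ⊢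
    intro a
    have := ht (s a)
    simpa [Tableau.col] using this
  · intro t _
    group
  · intro t _
    group
  · intro t _
    rw [map_smul, ← Module.End.mul_apply, ← map_mul, ← Module.End.mul_apply, ← map_mul]
    have h1 : Equiv.Perm.sign (s * t * s⁻¹) = Equiv.Perm.sign t := by
      rw [map_mul, map_mul, mul_right_comm, ← map_mul, mul_inv_cancel, map_one, one_mul]
    rw [h1]
    congr 3
    group

/-- The span of all polytabloids of shape `lam`, a subrepresentation of `M^lam`. -/
def spechtSub {n : ℕ} (lam : n.Partition) : Subrepresentation (rowRep n) where
  toSubmodule := Submodule.span ℂ (Set.range (polytabloid (lam := lam)))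
  apply_mem_toSubmodule s v hv := by
    induction hv using Submodule.span_induction with
    | mem x hx =>
      obtain ⟨T, rfl⟩ := hx
      rw [rowRep_polytabloid]
      exact Submodule.subset_span ⟨_, rfl⟩
    | zero => simp
    | add x y _ _ hx hy => rw [map_add]; exact Submodule.add_mem _ hx hy
    | smul c x _ hx => rw [map_smul]; exact Submodule.smul_mem _ c hx

/-- The Specht module `W^lam_{ℂ S_n}`, the complex irreducible representation of the symmetric
group indexed by `lam`: the span of all polytabloids of shape `lam`. -/
def Specht {n : ℕ} (lam : n.Partition) : Type := (spechtSub lam).toSubmodule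

instance {n : ℕ} (lam : n.Partition) : AddCommGroup (Specht lam) :=
  inferInstanceAs (AddCommGroup (spechtSub lam).toSubmodule)

instance {n : ℕ} (lam : n.Partition) : Module ℂ (Specht lam) :=
  inferInstanceAs (Module ℂ (spechtSub lam).toSubmodule)

/-- The action of the symmetric group on the Specht module. -/
def spechtRep {n : ℕ} (lam : n.Partition) :
    Representation ℂ (Equiv.Perm (Fin n)) (Specht lam) :=
  (spechtSub lam).toRepresentation

/-! ### Centralizer algebras and their modules -/

section Centralizer

variable {G U V : Type*} [Group G] [AddCommGroup U] [Module ℂ U] [AddCommGroup V] [Module ℂ V]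

/-- `End_{ℂ G}(V)`: the algebra of the endomorphisms of `V` that commute with the action of `G`. -/
def centralizer (rho : Representation ℂ G V) : Subalgebra ℂ (Module.End ℂ V) :=
  Subalgebra.centralizer ℂ (Set.range rho)

/-- `Hom_{ℂ G}(U, V)`: the linear maps `U → V` that commute with the actions of `G`. -/
def equivariantHom (tau : Representation ℂ G U) (rho : Representation ℂ G V) :
    Submodule ℂ (U →ₗ[ℂ] V) where
  carrier := {f | ∀ g : G, f ∘ₗ tau g = rho g ∘ₗ f}
  zero_mem' g := by rw [LinearMap.zero_comp, LinearMap.comp_zero]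
  add_mem' hf hf' g := by rw [LinearMap.add_comp, LinearMap.comp_add, hf g, hf' g]
  smul_mem' c f hf g := by rw [LinearMap.smul_comp, LinearMap.comp_smul, hf g]

/-- `End_{ℂ G}(V)` acts on `Hom_{ℂ G}(U, V)` by composition: `a • f = a ∘ f`. -/
instance (tau : Representation ℂ G U) (rho : Representation ℂ G V) :
    Module (centralizer rho) (equivariantHom tau rho) where
  smul a f := ⟨(a : Module.End ℂ V) ∘ₗ f.1, fun g => by
    have ha : rho g * a.1 = a.1 * rho g :=
      (Subalgebra.mem_centralizer_iff ℂ).1 a.2 _ ⟨g, rfl⟩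
    rw [LinearMap.comp_assoc, f.2 g, ← LinearMap.comp_assoc, ← LinearMap.comp_assoc,
      ← Module.End.mul_eq_comp, ← Module.End.mul_eq_comp, ha]⟩
  one_smul _ := rfl
  mul_smul _ _ _ := rfl
  smul_zero _ := Subtype.ext (LinearMap.comp_zero _)
  smul_add _ _ _ := Subtype.ext (LinearMap.comp_add _ _ _)
  add_smul _ _ _ := Subtype.ext (LinearMap.add_comp _ _ _)
  zero_smul _ := Subtype.ext (LinearMap.zero_comp _)

end Centralizer

/-- The symmetric group acting on the polynomial functions on `n × k` matrices by permuting the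
rows, `s · x_{i,j} = x_{s(i),j}`. -/
def polyRep (n k : ℕ) :
    Representation ℂ (Equiv.Perm (Fin n)) (MvPolynomial (Fin n × Fin k) ℂ) where
  toFun s := (MvPolynomial.rename (R := ℂ) (Prod.map ⇑s (id : Fin k → Fin k))).toLinearMap
  map_one' := by
    refine LinearMap.ext fun p => ?_
    simp
  map_mul' s t := by
    refine LinearMap.ext fun p => ?_
    simp only [Module.End.mul_apply, AlgHom.toLinearMap_apply, MvPolynomial.rename_rename]
    rfl

/-- The homogeneous polynomials of degree `r`, as a subrepresentation. -/
def homPolySub (r k n : ℕ) : Subrepresentation (polyRep n k) where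
  toSubmodule := MvPolynomial.homogeneousSubmodule (Fin n × Fin k) ℂ r
  apply_mem_toSubmodule s p hp := by
    rw [MvPolynomial.mem_homogeneousSubmodule] at hp ⊢
    exact hp.rename_isHomogeneous

/-- `P^r(V_{n,k})`: the homogeneous polynomials of degree `r`. -/
def HomPoly (r k n : ℕ) : Type := (homPolySub r k n).toSubmodule

instance (r k n : ℕ) : AddCommGroup (HomPoly r k n) :=
  inferInstanceAs (AddCommGroup (homPolySub r k n).toSubmodule)

instance (r k n : ℕ) : Module ℂ (HomPoly r k n) :=
  inferInstanceAs (Module ℂ (homPolySub r k n).toSubmodule)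

/-- The action of the symmetric group on `P^r(V_{n,k})`. -/
def homPolyRep (r k n : ℕ) : Representation ℂ (Equiv.Perm (Fin n)) (HomPoly r k n) :=
  (homPolySub r k n).toRepresentation

/-- The centralizer algebra `A_{r,k}(n) = End_{ℂ S_n}(P^r(V_{n,k}))`. -/
abbrev CentralizerAlgebra (r k n : ℕ) : Type :=
  centralizer (homPolyRep r k n)

/-- The module `W^lam_{A_{r,k}(n)} = Hom_{ℂ S_n}(W^lam_{ℂ S_n}, P^r(V_{n,k}))` over
`A_{r,k}(n)`. -/
abbrev CentralizerModule (r k : ℕ) {n : ℕ} (lam : n.Partition) : Type :=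
  equivariantHom (spechtRep lam) (homPolyRep r k n)

/-! ### Symmetric functions and plethysm -/

/-- The ring of symmetric functions `ℚ[p_1, p_2, p_3, …]`. -/
abbrev SymFn : Type := MvPolynomial ℕ+ ℚ

/-- The power sum generator `p_i` for `i ≥ 1` (it is only used for such `i`). -/
def psum (i : ℕ) : SymFn := MvPolynomial.X i.toPNat'

/-- `z_mu = ∏_{i ≥ 1} i ^ m_i(mu) * m_i(mu)!`. -/
def zNumber {n : ℕ} (mu : n.Partition) : ℕ :=
  ∏ i ∈ mu.parts.toFinset, i ^ mu.parts.count i * (mu.parts.count i).factorial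

/-- The complete homogeneous symmetric function `h_m = ∑_{mu ⊢ m} p_mu / z_mu`. -/
def hsymm (m : ℕ) : SymFn :=
  ∑ mu : m.Partition, MvPolynomial.C (zNumber mu : ℚ)⁻¹ * (mu.parts.map psum).prod

/-- `h_m` for an integer index, with `h_m = 0` for `m < 0`. -/
def hsymmInt (m : ℤ) : SymFn := if 0 ≤ m then hsymm m.toNat else 0

/-- The Schur function `s_lam = det (h_{lam_i - i + j})_{1 ≤ i, j ≤ ℓ(lam)}`. -/
def schur {n : ℕ} (lam : n.Partition) : SymFn :=
  Matrix.det (Matrix.of fun i j : Fin (Multiset.card lam.parts) =>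
    hsymmInt ((part lam ((i : ℕ) + 1) : ℤ) - ((i : ℕ) : ℤ) + ((j : ℕ) : ℤ)))

/-- The plethystic evaluation `f[E(q)]`: each `p_m` is replaced by `E(q ^ m)`. -/
def plethysm (f : SymFn) (E : PowerSeries ℚ) : PowerSeries ℚ :=
  MvPolynomial.aeval (fun m : ℕ+ => PowerSeries.expand (m : ℕ) m.ne_zero E) f

/-! ### The nonvanishing bound -/

/-- `t_d = C(k-1, 0) + C(k, 1) + ⋯ + C(k+d-2, d-1)` (for `k ≥ 1`). -/
def threshold (k d : ℕ) : ℕ := ∑ m ∈ Finset.range d, (k + m - 1).choose m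

/-- `∑_{j ≥ 1} (j - 1) * ∑_{t_{j-1} < i ≤ t_j} lam_i`, written with `d = j - 1`. For `k ≥ 1` only
finitely many terms are nonzero, since `t_d ≥ d`. -/
def minDegree (k : ℕ) {n : ℕ} (lam : n.Partition) : ℕ :=
  ∑ᶠ d : ℕ, d * ∑ i ∈ Finset.Icc (threshold k d + 1) (threshold k (d + 1)), part lam i

end MultisetPartition

end

/-!
The dimension and the nonvanishing of `Hom(S^lam, P^r)` are obtained from two descriptions of the
homomorphisms out of the Specht module, one by characters and one by fillings of tableaux.

*Fillings.* A homomorphism out of the Specht module is determined by the image of one polytabloid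
`e_T` (`intertwining_ext`), which is alternating under the column permutations of `T`. If the target
has a basis of words, only the words without repetitions in the columns of `T` can occur in this
image (`Tableau.colInjective_of_alternating`). A set of `m` letters then occupies at most as many
cells as the first `m` rows have (`Tableau.ColInjective.card_le`). This inequality, with its
equality case `Tableau.ColInjective.exists_colStable` in the first two items, is used three times:

* `finrank_end_specht`: the endomorphisms of the Specht module are the scalars;
* `finrank_specht_wordRep`: there are no homomorphisms to the permutation module of content
  `lam_i - i + s(i)` unless `s = 1`, when they form a line;
* `minDegree_le_of_colInjective`: the monomials of degree `r` in the variables `x_{a,j}` are words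
  of length `n` whose letters are monomials in `k` variables. As there are `t_d` letters of degree
  less than `d`, the smallest degree of a filling is attained by putting the `i`-th letter into the
  `i`-th row, and it is `minDegree k lam`. Substituting letters for rows in the tabloids realizes
  this degree, and multiplication by an invariant linear form gives all higher degrees.

*Characters.* Let `detChar lam` be the alternating sum over `s` of the characters of the permutation
modules of content `lam_i - i + s(i)`. Its scalar product with the Specht character is `1`, by
`finrank_specht_wordRep`. Its norm is an alternating sum of numbers of matrices with given row and
column sums, which is a coefficient in Cauchy's determinant identity and equals `1`
(`sum_sign_mul_matrixCount`). The Specht character is real and has norm `1`, so the two agree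
(`character_spechtRep`). The dimension of `Hom(S^lam, P^r)` is therefore an alternating sum of
numbers of orbits on pairs of a word and a monomial. These orbits are families of multisets of
monomials, and Burnside's lemma, applied to permutations sorted by cycle type, identifies the
generating series of multisets of `m` monomials with the plethysm of `h_m` (`plethysm_hsymm`). What
results is the Jacobi-Trudi determinant (`finrank_intertwining_eq_coeff`).

*Simplicity.* Averaging and Schur's lemma give every nonzero homomorphism an equivariant left
inverse (`exists_left_inverse`), so every nonzero element of `Hom(S^lam, V)` generates it over the
centralizer algebra of `V`.
-/

noncomputable section

namespace MultisetPartition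

open Finset Representation

/-! ### Parts of a partition and the cells of its diagram -/

section Parts

variable {n : ℕ} (lam : n.Partition)

theorem part_eq_zero_of_card_le {i : ℕ} (h : Multiset.card lam.parts ≤ i) :
    part lam (i + 1) = 0 := by
  unfold part
  rw [List.getD_eq_default]
  simpa using h

theorem part_antitone : Antitone fun i => part lam (i + 1) := by
  intro i j hij
  have hp : (lam.parts.sort (fun a b => b ≤ a)).Pairwise (fun a b => b ≤ a) :=
    Multiset.pairwise_sort _ _
  simp only [part, Nat.add_sub_cancel]
  by_cases hj : j < (lam.parts.sort (fun a b => b ≤ a)).length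
  · rw [List.getD_eq_getElem _ _ hj, List.getD_eq_getElem _ _ (hij.trans_lt hj)]
    rcases hij.eq_or_lt with rfl | h
    · rfl
    · exact List.pairwise_iff_getElem.1 hp i j _ _ h
  · rw [List.getD_eq_default _ _ (not_lt.1 hj)]
    exact Nat.zero_le _

/-- The rows beyond the first `ℓ(lam)` are empty, so `lam_1 + ⋯ + lam_ℓ` counts the cells. -/
theorem sum_part : ∑ i : Fin (Multiset.card lam.parts), part lam ((i : ℕ) + 1) = n := by
  have hlen : (lam.parts.sort (fun a b => b ≤ a)).length = Multiset.card lam.parts := by simp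
  have h : (lam.parts.sort (fun a b => b ≤ a)).sum = n := by
    rw [← Multiset.sum_coe, Multiset.sort_eq, lam.parts_sum]
  conv_rhs => rw [← h]
  rw [← Fin.sum_univ_getElem]
  refine Fintype.sum_equiv (finCongr hlen.symm) _ _ fun i => ?_
  simp only [part, Nat.add_sub_cancel, finCongr_apply]
  rw [List.getD_eq_getElem]
  rfl

/-- The cells of the diagram, listed row by row. -/
def cellEquiv : (Σ i : Fin (Multiset.card lam.parts), Fin (part lam ((i : ℕ) + 1))) ≃ Cell lam where
  toFun x := ⟨(x.1, x.2), x.2.2⟩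
  invFun c := ⟨⟨c.1.1, by
    by_contra h
    have := c.2
    rw [part_eq_zero_of_card_le lam (not_lt.1 h)] at this
    exact Nat.not_lt_zero _ this⟩, ⟨c.1.2, c.2⟩⟩
  left_inv _ := rfl
  right_inv _ := rfl

instance : Finite (Cell lam) := Finite.of_equiv _ (cellEquiv lam)

theorem card_cell : Nat.card (Cell lam) = n := by
  rw [← Nat.card_congr (cellEquiv lam), Nat.card_eq_fintype_card, Fintype.card_sigma]
  simpa using sum_part lam

instance : Nonempty (Tableau lam) :=
  ⟨(Finite.equivFinOfCardEq (card_cell lam)).symm⟩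

end Parts

/-! ### Fillings that are injective on the columns of a tableau -/

namespace Tableau

variable {n : ℕ} {lam : n.Partition} (T : Tableau lam)

theorem ext_row_col {a b : Fin n} (hr : T.row a = T.row b) (hc : T.col a = T.col b) : a = b :=
  T.injective (Subtype.ext (Prod.ext hr hc))

theorem exists_of_row_le {a : Fin n} {i : ℕ} (h : i ≤ T.row a) :
    ∃ b, T.row b = i ∧ T.col b = T.col a :=
  ⟨T.symm ⟨(i, T.col a), (T a).2.trans_le (part_antitone lam h)⟩, by simp [row], by simp [col]⟩

theorem card_row_eq (i : ℕ) : #{a | T.row a = i} = part lam (i + 1) := by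
  rw [← card_range (part lam (i + 1))]
  refine card_bij (fun a _ => T.col a) ?_ ?_ ?_
  · intro a ha
    simp only [mem_filter, mem_univ, true_and] at ha
    subst ha
    exact mem_range.2 (T a).2
  · intro a ha b hb h
    simp only [mem_filter, mem_univ, true_and] at ha hb
    exact T.ext_row_col (ha.trans hb.symm) h
  · intro j hj
    exact ⟨T.symm ⟨(i, j), mem_range.1 hj⟩, mem_filter.2 ⟨mem_univ _, by simp [row]⟩, by simp [col]⟩

theorem row_lt (a : Fin n) : T.row a < Multiset.card lam.parts := by
  by_contra h
  have := (T a).2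
  rw [← Tableau.row, part_eq_zero_of_card_le lam (not_lt.1 h)] at this
  exact Nat.not_lt_zero _ this

/-- A filling `g` of the tableau (entry `a` receives the letter `g a`) without repetitions in the
columns. -/
def ColInjective {B : Type*} (g : Fin n → B) : Prop :=
  ∀ a b, T.col a = T.col b → g a = g b → a = b

/-- The permutations preserving the columns of the tableau. -/
def ColStable (s : Equiv.Perm (Fin n)) : Prop := ∀ a, T.col (s a) = T.col a

variable {T}

theorem ColInjective.card_col_le {B : Type*} [DecidableEq B] {g : Fin n → B}
    (hg : T.ColInjective g) (S : Finset B) (c : ℕ) :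
    #{a | g a ∈ S ∧ T.col a = c} ≤ #{a | T.row a < #S ∧ T.col a = c} := by
  by_cases h : ∀ a, T.col a = c → T.row a < #S
  · refine card_le_card fun a ha => ?_
    simp only [mem_filter, mem_univ, true_and] at ha ⊢
    exact ⟨h a ha.2, ha.2⟩
  · push Not at h
    obtain ⟨a₀, rfl, ha⟩ := h
    calc #{a | g a ∈ S ∧ T.col a = T.col a₀} ≤ #S := by
          refine card_le_card_of_injOn g (fun a ha => ?_) fun a ha b hb => ?_
          · simp only [coe_filter, mem_univ, true_and, Set.mem_ofPred_eq] at ha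
            exact ha.1
          · simp only [coe_filter, mem_univ, true_and, Set.mem_ofPred_eq] at ha hb
            exact hg a b (ha.2.trans hb.2.symm)
      _ = #(range #S) := (card_range _).symm
      _ ≤ #(image T.row {a | T.row a < #S ∧ T.col a = T.col a₀}) := by
          refine card_le_card fun i hi => ?_
          obtain ⟨b, hb, hbc⟩ := T.exists_of_row_le ((mem_range.1 hi).le.trans ha)
          simp only [mem_image, mem_filter, mem_univ, true_and]
          exact ⟨b, ⟨hb ▸ mem_range.1 hi, hbc⟩, hb⟩
      _ ≤ _ := card_image_le

/-- A letter occurs at most once per column, so the letters of `S` occupy at most as many cells as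
the first `#S` rows have: this is where the dominance order comes from. -/
theorem ColInjective.card_le {B : Type*} [DecidableEq B] {g : Fin n → B}
    (hg : T.ColInjective g) (S : Finset B) : #{a | g a ∈ S} ≤ #{a | T.row a < #S} := by
  have hmaps : ∀ p : Fin n → Prop, [DecidablePred p] →
      #{a | p a} = ∑ c ∈ univ.image T.col, #{a | p a ∧ T.col a = c} := fun p _ => by
    rw [card_eq_sum_card_fiberwise (f := T.col) (t := univ.image T.col)]
    · simp only [filter_filter]
    · intro a _
      simp
  rw [hmaps, hmaps]
  exact sum_le_sum fun c _ => hg.card_col_le S c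

/-- Up to column permutations, the only column injective filling with `lam_i` letters `i` for all
`i` is the one that puts `i` into the `i`-th row. -/
theorem ColInjective.exists_colStable {g : Fin n → ℕ} (hg : T.ColInjective g)
    (hcard : ∀ i, #{a | g a = i} = part lam (i + 1)) :
    ∃ s : Equiv.Perm (Fin n), T.ColStable s ∧ g = T.row ∘ s := by
  -- the inequalities of `card_col_le` for the letters below `m` add up to an equality, so each of
  -- them is an equality
  have hcol : ∀ m, ∀ c ∈ univ.image T.col,
      #{a | g a ∈ range m ∧ T.col a = c} = #{a | T.row a ∈ range m ∧ T.col a = c} := by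
    intro m
    have hmaps : ∀ f : Fin n → ℕ, #{a | f a ∈ range m} =
        ∑ c ∈ univ.image T.col, #{a | f a ∈ range m ∧ T.col a = c} := fun f => by
      rw [card_eq_sum_card_fiberwise (f := T.col) (t := univ.image T.col)]
      · simp only [filter_filter]
      · intro a _
        simp
    have hrows : ∀ f : Fin n → ℕ, #{a | f a ∈ range m} = ∑ i ∈ range m, #{a | f a = i} :=
      fun f => by
        rw [card_eq_sum_card_fiberwise (f := f) (t := range m)]
        · refine sum_congr rfl fun i hi => ?_
          rw [filter_filter]
          congr 1
          ext a
          simp only [mem_filter, mem_univ, true_and, and_iff_right_iff_imp]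
          rintro rfl
          exact hi
        · intro a ha
          simpa using ha
    refine (sum_eq_sum_iff_of_le fun c _ => ?_).1 ?_
    · simpa using hg.card_col_le (range m) c
    · rw [← hmaps, ← hmaps, hrows, hrows]
      exact sum_congr rfl fun i _ => (hcard i).trans (T.card_row_eq i).symm
  -- comparing `m = g a` with `m = g a + 1`: the column of `a` has a cell in the row `g a`
  have hcell : ∀ a, ∃ b, T.row b = g a ∧ T.col b = T.col a := by
    intro a
    by_contra! h
    have h0 := hcol (g a) (T.col a) (by simp)
    have h1 := hcol (g a + 1) (T.col a) (by simp)
    have h2 : #{b | T.row b ∈ range (g a + 1) ∧ T.col b = T.col a} =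
        #{b | T.row b ∈ range (g a) ∧ T.col b = T.col a} := by
      congr 1
      ext b
      have := h b
      simp only [mem_filter, mem_univ, true_and, mem_range]
      grind
    have h3 : #{b | g b ∈ range (g a) ∧ T.col b = T.col a} <
        #{b | g b ∈ range (g a + 1) ∧ T.col b = T.col a} := by
      refine card_lt_card (ssubset_iff_of_subset (fun b hb => ?_) |>.2 ⟨a, ?_, ?_⟩)
      · simp only [mem_filter, mem_univ, true_and, mem_range] at hb ⊢
        exact ⟨by lia, hb.2⟩
      · simp
      · simp
    lia
  choose s hs hsc using hcell
  have hinj : Function.Injective s := fun a b hab =>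
    hg a b (by rw [← hsc, hab, hsc]) (by rw [← hs, hab, hs])
  exact ⟨Equiv.ofBijective s (Finite.injective_iff_bijective.1 hinj), hsc,
    funext fun a => (hs a).symm⟩

/-- A function on fillings that is alternating under the column permutations vanishes on fillings
with a repetition in a column. -/
theorem colInjective_of_alternating {B : Type*} {v : (Fin n → B) → ℂ}
    (hv : ∀ s : Equiv.Perm (Fin n), T.ColStable s →
      ∀ g, v (g ∘ s) = ((Equiv.Perm.sign s : ℤ) : ℂ) * v g)
    {g : Fin n → B} (hg : v g ≠ 0) : T.ColInjective g := by
  intro a b hc hab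
  by_contra hne
  apply hg
  have h := hv (Equiv.swap a b) (fun x => by
    rcases eq_or_ne x a with rfl | hxa
    · rw [Equiv.swap_apply_left, hc]
    rcases eq_or_ne x b with rfl | hxb
    · rw [Equiv.swap_apply_right, hc]
    · rw [Equiv.swap_apply_of_ne_of_ne hxa hxb]) g
  have hgs : g ∘ Equiv.swap a b = g := by
    funext x
    rcases eq_or_ne x a with rfl | hxa
    · simp [hab]
    rcases eq_or_ne x b with rfl | hxb
    · simp [hab]
    · simp [Equiv.swap_apply_of_ne_of_ne hxa hxb]
  rw [hgs, Equiv.Perm.sign_swap hne] at h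
  push_cast at h
  linear_combination h / 2

end Tableau

/-! ### Homomorphisms out of the Specht module -/

section Polytabloid

variable {n : ℕ} {lam : n.Partition} (T : Tableau lam)

theorem rowRep_single (s : Equiv.Perm (Fin n)) (f : Fin n → ℕ) :
    rowRep n s (Finsupp.single f 1) = Finsupp.single (f ∘ ⇑s⁻¹) 1 := by
  simp [rowRep]

theorem rowRep_apply_comp (s : Equiv.Perm (Fin n)) (v : (Fin n → ℕ) →₀ ℂ) (g : Fin n → ℕ) :
    rowRep n s v g = v (g ∘ s) := by
  have h : Function.Injective fun f : Fin n → ℕ => f ∘ ⇑s⁻¹ :=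
    (Equiv.surjective s⁻¹).injective_comp_right
  have := Finsupp.mapDomain_apply h v (g ∘ s)
  rw [← this]
  simp only [rowRep, MonoidHom.coe_mk, OneHom.coe_mk, Finsupp.lmapDomain_apply]
  congr 1
  funext a
  simp

theorem rowRep_polytabloid_of_colStable {s : Equiv.Perm (Fin n)} (hs : T.ColStable s) :
    rowRep n s (polytabloid T) = ((Equiv.Perm.sign s : ℤ) : ℂ) • polytabloid T := by
  unfold polytabloid
  rw [map_sum, smul_sum]
  have hinv : ∀ a, T.col (s⁻¹ a) = T.col a := fun a => by
    simpa using (hs (s⁻¹ a)).symm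
  refine sum_bij' (fun t _ => s * t) (fun t _ => s⁻¹ * t) ?_ ?_ ?_ ?_ ?_
  · intro t ht
    simp only [mem_filter, mem_univ, true_and] at ht ⊢
    intro a
    rw [Equiv.Perm.mul_apply, hs, ht]
  · intro t ht
    simp only [mem_filter, mem_univ, true_and] at ht ⊢
    intro a
    rw [Equiv.Perm.mul_apply, hinv, ht]
  · intro t _
    group
  · intro t _
    group
  · intro t _
    rw [map_smul, ← Module.End.mul_apply, ← map_mul, smul_smul]
    congr 1
    rw [map_mul]
    have : ((Equiv.Perm.sign s : ℤ) : ℂ) * ((Equiv.Perm.sign s : ℤ) : ℂ) = 1 := by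
      rw [← Int.cast_mul, ← Units.val_mul, Int.units_mul_self]
      simp
    push_cast
    linear_combination -((Equiv.Perm.sign t : ℤ) : ℂ) * this

instance : DecidablePred T.ColStable := fun _ => inferInstanceAs (Decidable (∀ _, _))

theorem polytabloid_apply (g : Fin n → ℕ) :
    polytabloid T g = ∑ s : Equiv.Perm (Fin n) with T.ColStable s,
      if T.row ∘ ⇑s⁻¹ = g then ((Equiv.Perm.sign s : ℤ) : ℂ) else 0 := by
  unfold polytabloid
  rw [Finsupp.finsetSum_apply]
  refine sum_congr (by rfl) fun s _ => ?_
  rw [rowRep_single, Finsupp.smul_apply, Finsupp.single_apply, smul_eq_mul, mul_ite, mul_one,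
    mul_zero]

/-- The tabloid of `T` occurs in `e_T` only for the trivial column permutation. -/
theorem polytabloid_apply_row : polytabloid T T.row = 1 := by
  rw [polytabloid_apply, sum_eq_single 1]
  · simp
  · intro s hs hne
    rw [if_neg]
    intro h
    apply hne
    simp only [mem_filter, mem_univ, true_and] at hs
    refine Equiv.ext fun a => T.ext_row_col ?_ (hs a)
    have := congrFun h (s a)
    simpa using this.symm
  · intro h
    exact absurd (mem_filter.2 ⟨mem_univ _, fun _ => rfl⟩) h

theorem card_eq_of_polytabloid_ne_zero {g : Fin n → ℕ} (h : polytabloid T g ≠ 0) (i : ℕ) :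
    #{a | g a = i} = part lam (i + 1) := by
  rw [polytabloid_apply] at h
  obtain ⟨s, -, hs⟩ := exists_ne_zero_of_sum_ne_zero h
  have hg : T.row ∘ ⇑s⁻¹ = g := by
    by_contra hne
    exact hs (if_neg hne)
  subst hg
  rw [← T.card_row_eq i]
  refine card_equiv s⁻¹ fun a => ?_
  simp

/-- The polytabloid `e_T` as an element of the Specht module. -/
def spechtGen : Specht lam := ⟨polytabloid T, Submodule.subset_span ⟨T, rfl⟩⟩

theorem spechtRep_spechtGen_of_colStable {s : Equiv.Perm (Fin n)} (hs : T.ColStable s) :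
    spechtRep lam s (spechtGen T) = ((Equiv.Perm.sign s : ℤ) : ℂ) • spechtGen T :=
  Subtype.ext (rowRep_polytabloid_of_colStable T hs)

theorem spechtGen_ne_zero : spechtGen T ≠ 0 := by
  intro h
  have : polytabloid T = 0 := congrArg Subtype.val h
  simpa [this] using polytabloid_apply_row T

/-- The Specht module is generated by any polytabloid. -/
theorem intertwining_ext {V : Type*} [AddCommGroup V] [Module ℂ V]
    {rho : Representation ℂ (Equiv.Perm (Fin n)) V} {f f' : IntertwiningMap (spechtRep lam) rho}
    (h : f (spechtGen T) = f' (spechtGen T)) : f = f' := by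
  have key : ∀ x (hx : x ∈ Submodule.span ℂ (Set.range (polytabloid (lam := lam)))),
      f (⟨x, hx⟩ : (spechtSub lam).toSubmodule) = f' (⟨x, hx⟩ : (spechtSub lam).toSubmodule) := by
    intro x hx
    induction hx using Submodule.span_induction with
    | mem x hx =>
      obtain ⟨T', rfl⟩ := hx
      have hT : T' = ((T.trans T'.symm).symm.trans T : Tableau lam) := by
        ext a : 1
        simp
      have hgen : spechtGen T' = spechtRep lam (T.trans T'.symm) (spechtGen T) := by
        apply Subtype.ext
        change polytabloid T' = rowRep n _ (polytabloid T)
        rw [rowRep_polytabloid, ← hT]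
      change f (spechtGen T') = f' (spechtGen T')
      rw [hgen, f.isIntertwining, f'.isIntertwining, h]
    | zero => exact (map_zero f).trans (map_zero f').symm
    | add x y hx hy h₁ h₂ =>
      exact (map_add f (⟨x, hx⟩ : (spechtSub lam).toSubmodule) ⟨y, hy⟩).trans
        ((congrArg₂ _ h₁ h₂).trans (map_add f' _ _).symm)
    | smul c x hx h₁ =>
      exact (map_smul f c (⟨x, hx⟩ : (spechtSub lam).toSubmodule)).trans
        ((congrArg _ h₁).trans (map_smul f' _ _).symm)
  exact IntertwiningMap.ext (LinearMap.ext fun x => key x.1 x.2)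

instance : Finite (Tableau lam) := inferInstanceAs (Finite (Fin n ≃ Cell lam))

instance : FiniteDimensional ℂ (Specht lam) :=
  FiniteDimensional.span_of_finite ℂ (Set.finite_range (polytabloid (lam := lam)))

/-- The elements of the Specht module are supported on the tabloids of shape `lam`. -/
theorem card_eq_of_mem_specht {x : Specht lam} {g : Fin n → ℕ} (h : x.1 g ≠ 0) (i : ℕ) :
    #{a | g a = i} = part lam (i + 1) := by
  by_contra hne
  apply h
  obtain ⟨x, hx⟩ := x
  change x g = 0
  change x ∈ Submodule.span ℂ (Set.range (polytabloid (lam := lam))) at hx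
  clear h
  induction hx using Submodule.span_induction with
  | mem x hx =>
    obtain ⟨T', rfl⟩ := hx
    by_contra h
    exact hne (card_eq_of_polytabloid_ne_zero T' h i)
  | zero => rfl
  | add x y _ _ hx hy => rw [Finsupp.add_apply, hx, hy, add_zero]
  | smul c x _ hx => rw [Finsupp.smul_apply, hx, smul_zero]

end Polytabloid

section Schur

variable {n : ℕ} (lam : n.Partition)

/-- The evaluation of `f(e_T)` at the tabloid of `T` determines an endomorphism `f` of the Specht
module, because `f(e_T)` is alternating under the column permutations. -/
theorem finrank_end_specht :
    Module.finrank ℂ (IntertwiningMap (spechtRep lam) (spechtRep lam)) = 1 := by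
  obtain ⟨T⟩ : Nonempty (Tableau lam) := inferInstance
  refine (finrank_eq_one_iff_of_nonzero' (IntertwiningMap.id (spechtRep lam)) ?_).2 fun f => ?_
  · intro h
    exact spechtGen_ne_zero T (congrArg (fun f : IntertwiningMap _ _ => f (spechtGen T)) h)
  have halt : ∀ x : Specht lam, (∀ s : Equiv.Perm (Fin n), T.ColStable s →
      spechtRep lam s x = ((Equiv.Perm.sign s : ℤ) : ℂ) • x) → x.1 T.row = 0 → x = 0 := by
    intro x hx h0
    refine Subtype.ext (Finsupp.ext fun g => ?_)
    by_contra hg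
    have hx' : ∀ s : Equiv.Perm (Fin n), T.ColStable s →
        ∀ g, x.1 (g ∘ s) = ((Equiv.Perm.sign s : ℤ) : ℂ) * x.1 g := fun s hs g => by
      rw [← rowRep_apply_comp]
      exact DFunLike.congr_fun (congrArg Subtype.val (hx s hs)) g
    obtain ⟨s, hs, rfl⟩ := (Tableau.colInjective_of_alternating hx' hg).exists_colStable
      (card_eq_of_mem_specht hg)
    apply hg
    rw [hx' s hs, h0, mul_zero]
    rfl
  refine ⟨(f (spechtGen T)).1 T.row, intertwining_ext T ?_⟩
  rw [← sub_eq_zero]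
  refine halt _ (fun s hs => ?_) ?_
  · rw [map_sub, ← IntertwiningMap.isIntertwining, ← IntertwiningMap.isIntertwining,
      spechtRep_spechtGen_of_colStable T hs, map_smul, map_smul, smul_sub]
  · change (f (spechtGen T)).1 T.row * polytabloid T T.row - (f (spechtGen T)).1 T.row = 0
    rw [polytabloid_apply_row]
    ring

end Schur

/-! ### Words and Burnside's lemma -/

section Words

/-- The words `f` of length `n` in the alphabet `B` whose multiset of letters satisfies `P`; the
symmetric group permutes the positions. -/
abbrev Word (n : ℕ) {B : Type*} (P : Multiset B → Prop) : Type _ :=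
  {f : Fin n → B // P (univ.val.map f)}

variable {n : ℕ} {B B' : Type*}

theorem map_univ_comp_perm (f : Fin n → B) (s : Equiv.Perm (Fin n)) :
    univ.val.map (f ∘ s) = univ.val.map f := by
  rw [← Multiset.map_map, Multiset.map_univ_val_equiv]

theorem exists_perm_of_map_univ_eq {f g : Fin n → B} (h : univ.val.map f = univ.val.map g) :
    ∃ s : Equiv.Perm (Fin n), f ∘ s = g := by
  classical
  have hc : ∀ b, Nonempty ({x // g x = b} ≃ {x // f x = b}) := fun b => by
    refine ⟨Fintype.equivOfCardEq ?_⟩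
    have := congrArg (Multiset.count b) h
    rw [Multiset.count_map, Multiset.count_map] at this
    rw [Fintype.card_subtype, Fintype.card_subtype]
    simp only [eq_comm (a := b)] at this
    exact this.symm
  let e' : ∀ b, {x // g x = b} ≃ {x // f x = b} := fun b => (hc b).some
  refine ⟨((Equiv.sigmaFiberEquiv g).symm.trans (Equiv.sigmaCongrRight e')).trans
    (Equiv.sigmaFiberEquiv f), funext fun x => ?_⟩
  exact (e' (g x) ⟨x, rfl⟩).2

instance (P : Multiset B → Prop) : MulAction (Equiv.Perm (Fin n)) (Word n P) where
  smul s f := ⟨f.1 ∘ ⇑s⁻¹, by rw [map_univ_comp_perm]; exact f.2⟩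
  one_smul _ := rfl
  mul_smul _ _ _ := rfl

/-- The number of words fixed by the permutation `s`. -/
def fixedCount (P : Multiset B → Prop) (s : Equiv.Perm (Fin n)) : ℕ :=
  Nat.card {f : Fin n → B // P (univ.val.map f) ∧ f ∘ s = f}

theorem comp_inv_eq_iff (f : Fin n → B) (s : Equiv.Perm (Fin n)) :
    f ∘ ⇑s⁻¹ = f ↔ f ∘ s = f := by
  constructor <;> intro h
  · conv_lhs => rw [← h]
    funext a
    simp
  · conv_lhs => rw [← h]
    funext a
    simp

theorem fixedCount_eq_card_fixedBy (P : Multiset B → Prop) (s : Equiv.Perm (Fin n)) :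
    fixedCount P s = Nat.card (MulAction.fixedBy (Word n P) s) :=
  Nat.card_congr
    { toFun := fun f => ⟨⟨f.1, f.2.1⟩, Subtype.ext ((comp_inv_eq_iff _ _).2 f.2.2)⟩
      invFun := fun w => ⟨w.1.1, w.1.2, (comp_inv_eq_iff _ _).1 (congrArg Subtype.val w.2)⟩
      left_inv := fun _ => rfl
      right_inv := fun _ => rfl }

/-- The orbits of words are the multisets of letters. -/
def orbitEquiv (P : Multiset B → Prop) :
    MulAction.orbitRel.Quotient (Equiv.Perm (Fin n)) (Word n P) ≃
      {M : Multiset B // Multiset.card M = n ∧ P M} :=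
  Equiv.ofBijective
    (Quotient.lift (fun w : Word n P => ⟨univ.val.map w.1, by simp, w.2⟩) (by
      rintro w _ ⟨s, rfl⟩
      exact Subtype.ext (map_univ_comp_perm _ _)))
    ⟨by
      rintro ⟨w⟩ ⟨w'⟩ h
      obtain ⟨s, hs⟩ := exists_perm_of_map_univ_eq (congrArg Subtype.val h).symm
      exact Quotient.sound ⟨s⁻¹, Subtype.ext hs⟩, by
      rintro ⟨M, hM, hP⟩
      obtain ⟨l, rfl⟩ := Quot.exists_rep M
      obtain rfl : l.length = n := hM
      have hl : univ.val.map l.get = (l : Multiset B) := by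
        rw [Fin.univ_val_map, List.ofFn_get]
      exact ⟨Quotient.mk _ ⟨l.get, by rw [hl]; exact hP⟩, Subtype.ext hl⟩⟩

/-- Burnside's lemma for words. -/
theorem sum_fixedCount (P : Multiset B → Prop) [Finite (Word n P)] :
    ∑ s : Equiv.Perm (Fin n), fixedCount P s =
      Nat.card {M : Multiset B // Multiset.card M = n ∧ P M} * n.factorial := by
  classical
  have := Fintype.ofFinite (Word n P)
  have := Fintype.ofFinite (MulAction.orbitRel.Quotient (Equiv.Perm (Fin n)) (Word n P))
  have h := MulAction.sum_card_fixedBy_eq_card_orbits_mul_card_group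
    (Equiv.Perm (Fin n)) (Word n P)
  rw [Fintype.card_perm, Fintype.card_fin] at h
  rw [← Nat.card_congr (orbitEquiv P), Nat.card_eq_fintype_card, ← h]
  exact sum_congr rfl fun s _ => by rw [fixedCount_eq_card_fixedBy, Nat.card_eq_fintype_card]

/-- A pair of words is a word of pairs. -/
theorem fixedCount_mul (P : Multiset B → Prop) (Q : Multiset B' → Prop)
    (s : Equiv.Perm (Fin n)) :
    fixedCount P s * fixedCount Q s =
      fixedCount (fun M : Multiset (B × B') => P (M.map Prod.fst) ∧ Q (M.map Prod.snd)) s := by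
  unfold fixedCount
  rw [← Nat.card_prod]
  refine Nat.card_congr
    { toFun := fun x => ⟨fun a => (x.1.1 a, x.2.1 a), ?_, ?_⟩
      invFun := fun h => (⟨fun a => (h.1 a).1, ?_, ?_⟩, ⟨fun a => (h.1 a).2, ?_, ?_⟩)
      left_inv := fun _ => rfl
      right_inv := fun _ => rfl }
  · simpa only [Multiset.map_map] using ⟨x.1.2.1, x.2.2.1⟩
  · exact funext fun a => Prod.ext (congrFun x.1.2.2 a) (congrFun x.2.2.2 a)
  · exact (congrArg _ (Multiset.map_map _ _ _)).mp h.2.1.1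
  · exact funext fun a => congrArg Prod.fst (congrFun h.2.2 a)
  · exact (congrArg _ (Multiset.map_map _ _ _)).mp h.2.1.2
  · exact funext fun a => congrArg Prod.snd (congrFun h.2.2 a)

theorem finite_word_prod (P : Multiset B → Prop) (Q : Multiset B' → Prop) [Finite (Word n P)]
    [Finite (Word n Q)] :
    Finite (Word n fun M : Multiset (B × B') => P (M.map Prod.fst) ∧ Q (M.map Prod.snd)) := by
  refine Finite.of_injective
    (fun h => ((⟨fun a => (h.1 a).1, ?_⟩, ⟨fun a => (h.1 a).2, ?_⟩) : Word n P × Word n Q)) ?_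
  · exact (congrArg _ (Multiset.map_map _ _ _)).mp h.2.1
  · exact (congrArg _ (Multiset.map_map _ _ _)).mp h.2.2
  · intro h h' hh
    exact Subtype.ext (funext fun a => Prod.ext
      (congrFun (congrArg Subtype.val (Prod.ext_iff.1 hh).1) a)
      (congrFun (congrArg Subtype.val (Prod.ext_iff.1 hh).2) a))

/-- Burnside's lemma for pairs of words. -/
theorem sum_fixedCount_mul (P : Multiset B → Prop) (Q : Multiset B' → Prop) [Finite (Word n P)]
    [Finite (Word n Q)] :
    ∑ s : Equiv.Perm (Fin n), fixedCount P s * fixedCount Q s =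
      Nat.card {M : Multiset (B × B') //
        Multiset.card M = n ∧ P (M.map Prod.fst) ∧ Q (M.map Prod.snd)} * n.factorial := by
  have := finite_word_prod (n := n) P Q
  rw [← sum_fixedCount]
  exact sum_congr rfl fun s _ => fixedCount_mul P Q s

/-- The permutation representation on words. -/
def wordRep (n : ℕ) (P : Multiset B → Prop) :
    Representation ℂ (Equiv.Perm (Fin n)) (Word n P →₀ ℂ) where
  toFun s := Finsupp.lmapDomain ℂ ℂ (s • ·)
  map_one' := by ext; simp
  map_mul' s t := by ext; simp [mul_smul]

theorem wordRep_apply (P : Multiset B → Prop) (s : Equiv.Perm (Fin n)) (v : Word n P →₀ ℂ)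
    (w : Word n P) : wordRep n P s v (s • w) = v w :=
  Finsupp.mapDomain_apply (MulAction.injective s) v w

/-- The trace of a permutation of a basis is its number of fixed points. -/
theorem trace_of_basis_map {ι V : Type*} [AddCommGroup V] [Module ℂ V] [Finite ι]
    (b : Module.Basis ι ℂ V) (f : V →ₗ[ℂ] V) (p : ι → ι) (h : ∀ i, f (b i) = b (p i)) :
    LinearMap.trace ℂ V f = Nat.card {i // p i = i} := by
  classical
  have := Fintype.ofFinite ι
  rw [LinearMap.trace_eq_matrix_trace ℂ b, Matrix.trace, Nat.card_eq_fintype_card,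
    Fintype.card_subtype, Finset.card_eq_sum_ones, Nat.cast_sum, Finset.sum_filter]
  refine sum_congr rfl fun i _ => ?_
  rw [Matrix.diag_apply, LinearMap.toMatrix_apply, h, Module.Basis.repr_self,
    Finsupp.single_apply]
  simp

theorem character_wordRep (P : Multiset B → Prop) [Finite (Word n P)]
    (s : Equiv.Perm (Fin n)) : (wordRep n P).character s = fixedCount P s := by
  rw [character, trace_of_basis_map Finsupp.basisSingleOne _ (s • ·), fixedCount_eq_card_fixedBy]
  · rfl
  · intro w
    simp [wordRep]

end Words

/-! ### Contents -/

section Content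

variable {n l : ℕ}

/-- The letter `i` occurs `a i` times for all `i`; there is no such multiset if some `a i` is
negative. -/
def HasContent (a : Fin l → ℤ) (M : Multiset (Fin l)) : Prop := ∀ i, (M.count i : ℤ) = a i

instance (P : Multiset (Fin l) → Prop) : Finite (Word n P) :=
  Subtype.finite

theorem count_map_univ (f : Fin n → Fin l) (i : Fin l) :
    (univ.val.map f).count i = #{a | f a = i} := by
  rw [Multiset.count_map]
  simp only [eq_comm (a := i)]
  rfl

/-- The exponent `lam_i - i + s(i)` appearing in the Jacobi-Trudi determinant. -/
def shifted (lam : n.Partition) (s : Equiv.Perm (Fin (Multiset.card lam.parts)))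
    (i : Fin (Multiset.card lam.parts)) : ℤ :=
  (part lam ((i : ℕ) + 1) : ℤ) - ((i : ℕ) : ℤ) + ((s i : ℕ) : ℤ)

/-- The contents in the Jacobi-Trudi determinant all have size `n`. -/
theorem sum_shifted (lam : n.Partition) (s : Equiv.Perm (Fin (Multiset.card lam.parts))) :
    ∑ i, shifted lam s i = n := by
  unfold shifted
  rw [sum_add_distrib, sum_sub_distrib, Equiv.sum_comp s (fun i => ((i : ℕ) : ℤ)),
    sub_add_cancel, ← Nat.cast_sum, sum_part]

/-- A permutation that never increases the partial sums of `0, 1, 2, …` is the identity. -/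
theorem eq_one_of_sum_le {s : Equiv.Perm (Fin l)}
    (h : ∀ m : ℕ, ∑ i : Fin l with Fin.val i < m, ((s i : ℕ) : ℤ)
      ≤ ∑ i : Fin l with Fin.val i < m, ((i : ℕ) : ℤ)) : s = 1 := by
  have key : ∀ j : ℕ, ∀ hj : j < l, s ⟨j, hj⟩ = ⟨j, hj⟩ := by
    intro j
    induction j using Nat.strong_induction_on with
    | _ j ih =>
      intro hj
      have hsplit : ∀ f : Fin l → ℤ, ∑ i : Fin l with Fin.val i < j + 1, f i =
          f ⟨j, hj⟩ + ∑ i : Fin l with Fin.val i < j, f i := fun f => by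
        rw [← sum_insert (by simp)]
        congr 1
        ext i
        simp only [mem_filter, mem_univ, true_and, mem_insert, Fin.ext_iff]
        lia
      have h1 := h (j + 1)
      rw [hsplit, hsplit, sum_congr rfl (g := fun i : Fin l => ((i : ℕ) : ℤ))] at h1
      · have h2 : (s ⟨j, hj⟩ : ℕ) ≤ j := by simpa using h1
        rcases h2.lt_or_eq with h3 | h3
        · have h4 := ih _ h3 (h3.trans hj)
          have h5 := s.injective (h4.trans (Fin.ext rfl))
          have := congrArg Fin.val h5
          simp at this
          lia
        · exact Fin.ext h3
      · intro i hi
        rw [show i = ⟨i, i.2⟩ from rfl, ih i (by simpa using hi) i.2]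
  exact Equiv.ext fun i => key i i.2

/-- Dominance: there is no nonzero homomorphism from the Specht module to the permutation module
of content `lam_i - i + s(i)`, except for `s = 1`, where it is unique up to scalars. -/
theorem finrank_specht_wordRep (lam : n.Partition)
    (s : Equiv.Perm (Fin (Multiset.card lam.parts))) :
    Module.finrank ℂ (IntertwiningMap (spechtRep lam) (wordRep n (HasContent (shifted lam s)))) =
      if s = 1 then 1 else 0 := by
  obtain ⟨T⟩ : Nonempty (Tableau lam) := inferInstance
  have halt : ∀ f : IntertwiningMap (spechtRep lam) (wordRep n (HasContent (shifted lam s))),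
      ∀ t : Equiv.Perm (Fin n), T.ColStable t → ∀ w : Word n (HasContent (shifted lam s)),
        f (spechtGen T) (t⁻¹ • w) = ((Equiv.Perm.sign t : ℤ) : ℂ) * f (spechtGen T) w := by
    intro f t ht w
    have h := wordRep_apply _ t (f (spechtGen T)) (t⁻¹ • w)
    rw [smul_inv_smul, ← f.isIntertwining, spechtRep_spechtGen_of_colStable T ht, map_smul] at h
    exact h.symm
  have hinj : ∀ f : IntertwiningMap (spechtRep lam) (wordRep n (HasContent (shifted lam s))),
      ∀ w, f (spechtGen T) w ≠ 0 → T.ColInjective w.1 := by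
    classical
    intro f w hw
    refine Tableau.colInjective_of_alternating
      (v := fun g => if hg : HasContent (shifted lam s) (univ.val.map g)
        then f (spechtGen T) ⟨g, hg⟩ else 0) ?_ (g := w.1) ?_
    · intro t ht g
      have hc : HasContent (shifted lam s) (univ.val.map (g ∘ t)) ↔
        HasContent (shifted lam s) (univ.val.map g) := by rw [map_univ_comp_perm]
      by_cases hg : HasContent (shifted lam s) (univ.val.map g)
      · rw [dif_pos (hc.2 hg), dif_pos hg]
        exact halt f t ht ⟨g, hg⟩
      · rw [dif_neg (mt hc.1 hg), dif_neg hg, mul_zero]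
    · rw [dif_pos w.2]
      exact hw
  split_ifs with hs
  · subst hs
    -- for `s = 1` the words are the tabloids of shape `lam`, and restricting the elements of the
    -- Specht module to them gives a homomorphism `emb`
    have hcount : ∀ g : Fin n → Fin (Multiset.card lam.parts),
        HasContent (shifted lam 1) (univ.val.map g) ↔
          ∀ i : ℕ, #{a | (g a : ℕ) = i} = part lam (i + 1) := by
      intro g
      simp only [HasContent, shifted, Equiv.Perm.one_apply, sub_add_cancel, count_map_univ,
        Nat.cast_inj]
      refine ⟨fun h i => ?_, fun h i => ?_⟩
      · by_cases hi : i < Multiset.card lam.parts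
        · rw [← h ⟨i, hi⟩]
          simp only [Fin.ext_iff]
        · rw [part_eq_zero_of_card_le lam (not_lt.1 hi), card_eq_zero, filter_eq_empty_iff]
          exact fun a _ h => hi (h ▸ (g a).2)
      · rw [← h i]
        simp only [Fin.ext_iff]
    let w₀ : Word n (HasContent (shifted lam 1)) :=
      ⟨fun a => ⟨T.row a, T.row_lt a⟩, (hcount _).2 T.card_row_eq⟩
    have hval : Function.Injective fun w : Word n (HasContent (shifted lam 1)) =>
        (fun a => (w.1 a : ℕ)) := fun w w' h =>
      Subtype.ext (funext fun a => Fin.ext (congrFun h a))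
    have hemb : ∀ t : Equiv.Perm (Fin n), ∀ x : Specht lam,
        Finsupp.comapDomain (fun w : Word n (HasContent (shifted lam 1)) =>
          (fun a => (w.1 a : ℕ))) (spechtRep lam t x).1 hval.injOn =
        wordRep n (HasContent (shifted lam 1)) t (Finsupp.comapDomain
          (fun w : Word n (HasContent (shifted lam 1)) => (fun a => (w.1 a : ℕ))) x.1
            hval.injOn) := by
      intro t x
      refine Finsupp.ext fun w => ?_
      obtain ⟨w, rfl⟩ := MulAction.surjective t w
      rw [wordRep_apply, Finsupp.comapDomain_apply, Finsupp.comapDomain_apply]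
      change rowRep n t x.1 _ = _
      rw [rowRep_apply_comp]
      congr 1
      funext a
      change (w.1 (t⁻¹ (t a)) : ℕ) = _
      simp
    let emb : IntertwiningMap (spechtRep lam) (wordRep n (HasContent (shifted lam 1))) :=
      { toFun := fun x => Finsupp.comapDomain (fun w => (fun a => (w.1 a : ℕ))) x.1 hval.injOn
        map_add' := fun _ _ => Finsupp.ext fun _ => rfl
        map_smul' := fun _ _ => Finsupp.ext fun _ => rfl
        isIntertwining' := fun t => LinearMap.ext fun x => hemb t x }
    have hemb0 : emb (spechtGen T) w₀ = 1 := polytabloid_apply_row T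
    refine (finrank_eq_one_iff_of_nonzero' emb ?_).2 fun f => ?_
    · intro h
      rw [h] at hemb0
      exact zero_ne_one hemb0
    -- `f (e_T)` is determined by its coefficient at `w₀`, because column injective words of this
    -- content are column permutations of `w₀`
    refine ⟨f (spechtGen T) w₀, intertwining_ext T ?_⟩
    rw [← sub_eq_zero]
    change (f (spechtGen T) w₀ • emb - f) (spechtGen T) = 0
    have h0 : (f (spechtGen T) w₀ • emb - f) (spechtGen T) w₀ = 0 := by
      change f (spechtGen T) w₀ * emb (spechtGen T) w₀ - f (spechtGen T) w₀ = 0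
      rw [hemb0, mul_one, sub_self]
    generalize f (spechtGen T) w₀ • emb - f = f' at h0 ⊢
    refine Finsupp.ext fun w => ?_
    by_contra hw
    have hw' := hinj f' w hw
    obtain ⟨t, ht, htw⟩ := Tableau.ColInjective.exists_colStable (T := T)
      (g := fun a => (w.1 a : ℕ)) (fun a b hc hab => hw' a b hc (Fin.ext hab)) ((hcount _).1 w.2)
    have : w = t⁻¹ • w₀ := hval htw
    rw [this, halt f' t ht, h0, mul_zero] at hw
    exact hw rfl
  · have hsub : Subsingleton
        (IntertwiningMap (spechtRep lam) (wordRep n (HasContent (shifted lam s)))) := by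
      refine subsingleton_of_forall_eq 0 fun f => ?_
      refine intertwining_ext T (Finsupp.ext fun w => ?_)
      change f (spechtGen T) w = 0
      by_contra hw
      -- the first `m` letters fit into the first `m` rows, for every `m`
      refine hs (eq_one_of_sum_le fun m => ?_)
      have h := (hinj f w hw).card_le {i | Fin.val i < m}
      have hle : #{i : Fin (Multiset.card lam.parts) | Fin.val i < m} ≤ m := by
        calc _ ≤ #(range m) := card_le_card_of_injOn Fin.val (fun i hi => by simpa using hi)
                (Fin.val_injective.injOn)
          _ = m := card_range m
      have h1 : (#{a | w.1 a ∈ ({i | Fin.val i < m} : Finset (Fin (Multiset.card lam.parts)))} :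
          ℤ) = ∑ i : Fin (Multiset.card lam.parts) with Fin.val i < m, shifted lam s i := by
        rw [card_eq_sum_card_fiberwise (f := w.1)
          (t := ({i | Fin.val i < m} : Finset (Fin (Multiset.card lam.parts)))) (by
            intro a ha
            simpa using ha), Nat.cast_sum]
        refine sum_congr rfl fun i hi => ?_
        rw [← w.2 i, count_map_univ, filter_filter]
        congr 2
        ext a
        simp only [mem_filter, mem_univ, true_and, and_iff_right_iff_imp]
        rintro rfl
        simpa using hi
      have h2 : #{a | T.row a < m} =
          ∑ i : Fin (Multiset.card lam.parts) with Fin.val i < m, part lam ((i : ℕ) + 1) := by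
        rw [card_eq_sum_card_fiberwise (f := fun a => (⟨T.row a, T.row_lt a⟩ : Fin _))
          (t := ({i | Fin.val i < m} : Finset (Fin (Multiset.card lam.parts)))) (by
            intro a ha
            simpa using ha)]
        refine sum_congr rfl fun i hi => ?_
        rw [← T.card_row_eq i, filter_filter]
        congr 1
        ext a
        simp only [mem_filter, mem_univ, true_and, Fin.ext_iff, and_iff_right_iff_imp]
        rintro h
        simpa [h] using hi
      have h3 : #{a | T.row a < #{i : Fin (Multiset.card lam.parts) | Fin.val i < m}} ≤
          #{a | T.row a < m} := card_le_card fun a ha => by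
        simp only [mem_filter, mem_univ, true_and] at ha ⊢
        exact ha.trans_le hle
      have h4 : ∑ i : Fin (Multiset.card lam.parts) with Fin.val i < m, shifted lam s i ≤
          ∑ i : Fin (Multiset.card lam.parts) with Fin.val i < m, (part lam ((i : ℕ) + 1) : ℤ) := by
        rw [← h1, ← Nat.cast_sum, ← h2]
        exact_mod_cast h.trans h3
      unfold shifted at h4
      rw [sum_add_distrib, sum_sub_distrib] at h4
      linarith
    exact Module.finrank_zero_of_subsingleton

end Content

/-! ### The Cauchy determinant -/

section Cauchy

open Polynomial

variable {R : Type*} [CommRing R] {l : ℕ}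

/-- The reversal of `Q` gains a factor `1 - x y` when `Q` is multiplied by `X - y`. The reversal is
taken with respect to a bound `m` for the degree of `Q`, so that `Q` need not be monic. -/
theorem sum_coeff_X_sub_C_mul (Q : R[X]) (x y : R) {m : ℕ} (hQ : Q.natDegree ≤ m) :
    ∑ d ∈ range (m + 2), ((X - C y) * Q).coeff d * x ^ (m + 1 - d) =
      (1 - x * y) * ∑ d ∈ range (m + 1), Q.coeff d * x ^ (m - d) := by
  have h1 : ∑ d ∈ range (m + 2), Q.coeff d * x ^ (m + 1 - d) =
      x * ∑ d ∈ range (m + 1), Q.coeff d * x ^ (m - d) := by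
    rw [sum_range_succ, coeff_eq_zero_of_natDegree_lt (by lia), zero_mul, add_zero, mul_sum]
    refine sum_congr rfl fun d hd => ?_
    rw [Nat.succ_sub (by simpa [Nat.lt_succ_iff] using hd), pow_succ]
    ring
  rw [sum_range_succ'] at h1 ⊢
  have h2 : ∀ d, ((X - C y) * Q).coeff (d + 1) * x ^ (m + 1 - (d + 1)) =
      Q.coeff d * x ^ (m - d) - y * (Q.coeff (d + 1) * x ^ (m + 1 - (d + 1))) := fun d => by
    rw [sub_mul, coeff_sub, coeff_X_mul, coeff_C_mul, Nat.add_sub_add_right]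
    ring
  simp only [h2]
  rw [sum_sub_distrib, ← mul_sum, sub_mul, coeff_sub, coeff_C_mul, mul_coeff_zero, coeff_X_zero]
  linear_combination -y * h1

/-- The reversal of `∏_i (X - y i)` is `∏_i (1 - x y i)`. -/
theorem sum_coeff_prod_X_sub_C {ι : Type*} (s : Finset ι) (y : ι → R) (x : R) :
    ∑ d ∈ range (#s + 1), (∏ i ∈ s, (X - C (y i))).coeff d * x ^ (#s - d) =
      ∏ i ∈ s, (1 - x * y i) := by
  classical
  induction s using Finset.induction_on with
  | empty => simp
  | insert a s ha ih =>
    rw [prod_insert ha, prod_insert ha, card_insert_of_notMem ha, sum_coeff_X_sub_C_mul, ih]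
    refine (natDegree_prod_le _ _).trans ((sum_le_sum fun i _ => natDegree_X_sub_C_le _).trans ?_)
    simp

/-- Cauchy's determinant, with the denominators cleared. -/
theorem det_prod_erase [IsDomain R] (x : Fin l → R) {y : Fin l → R} (hy : Function.Injective y) :
    Matrix.det (Matrix.of fun i j => ∏ m ∈ univ.erase j, (1 - x i * y m)) =
      (Matrix.projVandermonde 1 x).det * (Matrix.projVandermonde 1 y).det := by
  -- both `projVandermonde 1 x` and `vandermonde y` evaluate the polynomials `∏_{m ≠ j} (X - y m)`
  let Q : Fin l → R[X] := fun j => ∏ m ∈ univ.erase j, (X - C (y m))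
  let A : Matrix (Fin l) (Fin l) R := Matrix.of fun d j => (Q j).coeff d
  have hcard : ∀ j : Fin l, #(univ.erase j) + 1 = l := fun j => by
    rw [card_erase_of_mem (mem_univ j), card_univ, Fintype.card_fin]
    have := j.2
    lia
  have hQ : ∀ j, (Q j).natDegree < l := fun j => by
    have : (Q j).natDegree ≤ #(univ.erase j) :=
      (natDegree_prod_le _ _).trans ((sum_le_sum fun i _ => natDegree_X_sub_C_le _).trans (by simp))
    have := hcard j
    lia
  have h1 : Matrix.of (fun i j => ∏ m ∈ univ.erase j, (1 - x i * y m)) =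
      Matrix.projVandermonde 1 x * A := by
    ext i j
    rw [Matrix.of_apply, Matrix.mul_apply, ← sum_coeff_prod_X_sub_C, hcard j]
    refine (Fin.sum_univ_eq_sum_range
      (fun d => (Q j).coeff d * x i ^ (#(univ.erase j) - d)) l).symm.trans ?_
    refine sum_congr rfl fun d _ => ?_
    have := hcard j
    rw [Matrix.projVandermonde_apply, Fin.val_rev, Pi.one_apply, one_pow, one_mul, mul_comm]
    congr 2
    lia
  have h2 : Matrix.vandermonde y * A =
      Matrix.diagonal fun j => ∏ m ∈ univ.erase j, (y j - y m) := by
    ext i j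
    have : (Matrix.vandermonde y * A) i j = (Q j).eval (y i) := by
      rw [Matrix.mul_apply, eval_eq_sum_range' (hQ j), ← Fin.sum_univ_eq_sum_range
        (fun d => (Q j).coeff d * y i ^ d)]
      exact sum_congr rfl fun d _ => mul_comm _ _
    rw [this]
    simp only [Q, eval_prod, eval_sub, eval_X, eval_C]
    rcases eq_or_ne i j with rfl | hij
    · rw [Matrix.diagonal_apply_eq]
    · rw [Matrix.diagonal_apply_ne _ hij]
      exact prod_eq_zero (mem_erase.2 ⟨hij, mem_univ _⟩) (sub_self _)
  have h3 : (∏ j, ∏ m ∈ univ.erase j, (y j - y m)) =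
      (Matrix.vandermonde y).det * (Matrix.projVandermonde 1 y).det := by
    rw [Matrix.det_vandermonde, Matrix.det_projVandermonde]
    simp only [Pi.one_apply, one_mul]
    rw [← prod_comm' (s := univ) (t := fun j => Iio j) (f := fun j m => y j - y m)
      (by simp), ← prod_mul_distrib]
    refine prod_congr rfl fun j _ => ?_
    rw [← prod_union (by
      rw [disjoint_left]
      intro m hm hm'
      simp only [mem_Iio, mem_Ioi] at hm hm'
      exact lt_asymm hm hm')]
    refine prod_congr ?_ fun _ _ => rfl
    ext m
    simp only [mem_erase, mem_univ, and_true, mem_union, mem_Iio, mem_Ioi]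
    exact ne_iff_lt_or_gt
  have h4 : (Matrix.vandermonde y).det ≠ 0 := Matrix.det_vandermonde_ne_zero_iff.2 hy
  rw [h1, Matrix.det_mul]
  congr 1
  refine mul_left_cancel₀ h4 ?_
  rw [← Matrix.det_mul, h2, Matrix.det_diagonal, h3]

end Cauchy

/-! ### Products of geometric series -/

section Geometric

variable {σ R : Type*} [CommRing R]

open Classical in
/-- The geometric series `∑_m x^(m e)` with exponent vector `e ≠ 0`; for `e = 0` the definition
gives `1`. -/
def geom (R : Type*) [CommRing R] (e : σ →₀ ℕ) : MvPowerSeries σ R :=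
  fun d => if ∃ m : ℕ, m • e = d then 1 else 0

open Classical in
theorem coeff_geom (e d : σ →₀ ℕ) :
    MvPowerSeries.coeff d (geom R e) = if ∃ m : ℕ, m • e = d then 1 else 0 := rfl

theorem one_sub_monomial_mul_geom {e : σ →₀ ℕ} (he : e ≠ 0) :
    (1 - MvPowerSeries.monomial e 1) * geom R e = 1 := by
  classical
  ext d
  rw [sub_mul, one_mul, map_sub, MvPowerSeries.coeff_monomial_mul, coeff_geom, coeff_geom,
    MvPowerSeries.coeff_one, one_mul]
  by_cases hd : d = 0
  · subst hd
    rw [if_pos ⟨0, zero_smul _ _⟩, if_neg (fun h => he (nonpos_iff_eq_zero.1 h)), if_pos rfl,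
      sub_zero]
  rw [if_neg hd]
  by_cases hed : e ≤ d
  · rw [if_pos hed, sub_eq_zero]
    congr 1
    apply propext
    constructor
    · rintro ⟨m, rfl⟩
      obtain ⟨m, rfl⟩ := Nat.exists_eq_succ_of_ne_zero (n := m) (by rintro rfl; simp at hd)
      exact ⟨m, by rw [Nat.succ_eq_add_one, add_smul, one_smul, add_tsub_cancel_right]⟩
    · rintro ⟨m, hm⟩
      exact ⟨m + 1, by rw [add_smul, one_smul, hm, tsub_add_cancel_of_le hed]⟩
  · rw [if_neg hed, sub_zero, if_neg]
    rintro ⟨m, rfl⟩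
    obtain ⟨m, rfl⟩ := Nat.exists_eq_succ_of_ne_zero (n := m) (by rintro rfl; simp at hd)
    exact hed (by rw [Nat.succ_eq_add_one, add_smul, one_smul]; exact le_add_self)

/-- The coefficients of a product of geometric series count the representations of the exponent
vector as a combination of the given ones. -/
theorem coeff_prod_geom {ι : Type*} [Fintype ι] {e : ι → σ →₀ ℕ} (he : ∀ i, e i ≠ 0)
    (d : σ →₀ ℕ) :
    MvPowerSeries.coeff d (∏ i, geom R (e i)) =
      Nat.card {N : ι → ℕ // ∑ i, N i • e i = d} := by
  classical
  rw [MvPowerSeries.coeff_prod]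
  have h1 : ∀ f ∈ finsuppAntidiag univ d,
      ∏ i, MvPowerSeries.coeff (f i) (geom R (e i)) =
        if ∀ i, ∃ m : ℕ, m • e i = f i then 1 else 0 := by
    intro f _
    split_ifs with h
    · exact prod_eq_one fun i _ => if_pos (h i)
    · push Not at h
      obtain ⟨i, hi⟩ := h
      exact prod_eq_zero (mem_univ i) (if_neg fun ⟨m, hm⟩ => hi m hm)
  rw [sum_congr rfl h1, sum_boole]
  rw [← Nat.card_eq_finsetCard]
  refine congrArg _ (Nat.card_congr (Equiv.ofBijective (fun N => ⟨Finsupp.equivFunOnFinite.symm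
    fun i => N.1 i • e i, mem_filter.2 ⟨mem_finsuppAntidiag.2 ⟨N.2, subset_univ _⟩,
      fun i => ⟨N.1 i, rfl⟩⟩⟩) ⟨?_, ?_⟩)).symm
  · intro N N' h
    refine Subtype.ext (funext fun i => ?_)
    have h2 : N.1 i • e i = N'.1 i • e i := DFunLike.congr_fun (congrArg Subtype.val h) i
    obtain ⟨a, ha⟩ := Finsupp.ne_iff.1 (he i)
    have h3 := DFunLike.congr_fun h2 a
    simp only [Finsupp.smul_apply, smul_eq_mul] at h3
    exact Nat.eq_of_mul_eq_mul_right (Nat.pos_of_ne_zero ha) h3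
  · rintro ⟨f, hf⟩
    rw [mem_filter, mem_finsuppAntidiag] at hf
    choose N hN using hf.2
    refine ⟨⟨N, ?_⟩, Subtype.ext (Finsupp.ext fun i => hN i)⟩
    simp only [hN]
    exact hf.1.1

end Geometric

/-! ### The alternating sum over integer matrices -/

section Norm

variable {l : ℕ}

/-- The number of matrices of natural numbers with row sums `a` and column sums `b`. The sums are
prescribed as integers, so that the number is `0` if one of them is negative. -/
def matrixCount (a b : Fin l → ℤ) : ℕ :=
  Nat.card {N : Fin l × Fin l → ℕ //
    (∀ i, ∑ j, (N (i, j) : ℤ) = a i) ∧ ∀ j, ∑ i, (N (i, j) : ℤ) = b j}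

/-- The exponent vector of `x^u y^v`. -/
def bivec (u v : Fin l → ℕ) : Fin l ⊕ Fin l →₀ ℕ := Finsupp.equivFunOnFinite.symm (Sum.elim u v)

/-- The Cauchy kernel `∏_{i,j} (1 - x_i y_j)⁻¹` is the generating function of the matrices of
natural numbers by their row and column sums; a monomial factor shifts these sums. -/
theorem coeff_monomial_mul_prod_geom (u v U V : Fin l → ℕ) :
    MvPowerSeries.coeff (bivec U V) (MvPowerSeries.monomial (bivec u v) (1 : ℤ) *
      ∏ c : Fin l × Fin l, geom ℤ (bivec (Pi.single c.1 1) (Pi.single c.2 1))) =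
    matrixCount (fun i => (U i : ℤ) - u i) (fun j => (V j : ℤ) - v j) := by
  classical
  have hne : ∀ c : Fin l × Fin l, bivec (Pi.single c.1 1) (Pi.single c.2 1) ≠ 0 := fun c h => by
    simpa [bivec] using DFunLike.congr_fun h (Sum.inl c.1)
  have hsum : ∀ N : Fin l × Fin l → ℕ,
      ∑ c, N c • bivec (Pi.single c.1 1) (Pi.single c.2 1) =
        bivec (fun i => ∑ j, N (i, j)) (fun j => ∑ i, N (i, j)) := by
    intro N
    ext (i | j)
    · simp [bivec, Finsupp.finsetSum_apply, Fintype.sum_prod_type, Pi.single_apply]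
    · simp [bivec, Finsupp.finsetSum_apply, Fintype.sum_prod_type, Pi.single_apply]
  have hle : ∀ u v U V : Fin l → ℕ, bivec u v ≤ bivec U V ↔ u ≤ U ∧ v ≤ V := by
    intro u v U V
    constructor
    · intro h
      exact ⟨fun i => h (Sum.inl i), fun i => h (Sum.inr i)⟩
    · rintro ⟨h1, h2⟩ (i | i)
      · exact h1 i
      · exact h2 i
  rw [MvPowerSeries.coeff_monomial_mul, one_mul, matrixCount]
  split_ifs with h
  · rw [coeff_prod_geom hne]
    congr 1
    refine Nat.card_congr (Equiv.subtypeEquivRight fun N => ?_)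
    rw [hsum, eq_tsub_iff_add_eq_of_le h]
    have hadd : ∀ u v u' v' : Fin l → ℕ, bivec u v + bivec u' v' = bivec (u + u') (v + v') := by
      intros
      ext (i | i) <;> rfl
    rw [hadd, le_antisymm_iff, hle, hle, and_and_and_comm, ← le_antisymm_iff, ← le_antisymm_iff,
      funext_iff, funext_iff]
    refine and_congr (forall_congr' fun i => ?_) (forall_congr' fun i => ?_)
    · rw [eq_sub_iff_add_eq]
      exact_mod_cast Iff.rfl
    · rw [eq_sub_iff_add_eq]
      exact_mod_cast Iff.rfl
  · symm
    rw [Nat.cast_eq_zero, Nat.card_eq_zero]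
    left
    refine ⟨fun N => h ((hle _ _ _ _).2 ⟨fun i => ?_, fun i => ?_⟩)⟩
    · have h1 := N.2.1 i
      have h2 : 0 ≤ ∑ j, (N.1 (i, j) : ℤ) := sum_nonneg fun _ _ => by positivity
      lia
    · have h1 := N.2.2 i
      have h2 : 0 ≤ ∑ j, (N.1 (j, i) : ℤ) := sum_nonneg fun _ _ => by positivity
      lia

/-- The alternants `∑_s sgn(s) x^(s δ)`, as generalized Vandermonde determinants. -/
theorem det_projVandermonde_eq_sum {R : Type*} [CommRing R] (x : Fin l → R) :
    (Matrix.projVandermonde 1 x).det =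
      ∑ s : Equiv.Perm (Fin l), ((Equiv.Perm.sign s : ℤ) : R) * ∏ i, x i ^ ((s i).rev : ℕ) := by
  rw [← Matrix.det_transpose, Matrix.det_apply']
  refine sum_congr rfl fun s _ => ?_
  congr 1
  refine prod_congr rfl fun i _ => ?_
  rw [Matrix.transpose_apply, Matrix.projVandermonde_apply, Pi.one_apply, one_pow, one_mul]

/-- Extracting the coefficient of `x^U y^U` from Cauchy's identity, for strictly decreasing `U`. -/
theorem sum_sign_mul_matrixCount {U : Fin l → ℕ} (hU : StrictAnti U) :
    ∑ s : Equiv.Perm (Fin l), ∑ t : Equiv.Perm (Fin l),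
      ((Equiv.Perm.sign s : ℤ) * (Equiv.Perm.sign t : ℤ)) *
        (matrixCount (fun i => (U i : ℤ) - ((s i).rev : ℕ))
          (fun i => (U i : ℤ) - ((t i).rev : ℕ)) : ℤ) = 1 := by
  classical
  have : IsDomain (MvPowerSeries (Fin l ⊕ Fin l) ℤ) := NoZeroDivisors.to_isDomain _
  let x : Fin l → MvPowerSeries (Fin l ⊕ Fin l) ℤ := fun i => MvPowerSeries.X (Sum.inl i)
  let y : Fin l → MvPowerSeries (Fin l ⊕ Fin l) ℤ := fun i => MvPowerSeries.X (Sum.inr i)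
  let e : Fin l × Fin l → (Fin l ⊕ Fin l →₀ ℕ) := fun c => bivec (Pi.single c.1 1) (Pi.single c.2 1)
  have hne : ∀ c, e c ≠ 0 := fun c h => by
    simpa [e, bivec] using DFunLike.congr_fun h (Sum.inl c.1)
  have hy : Function.Injective y := fun i j h => by
    have := congrArg (MvPowerSeries.coeff (Finsupp.single (Sum.inr i) 1)) h
    simp only [y, MvPowerSeries.coeff_X, Finsupp.single_left_inj one_ne_zero, if_true] at this
    by_contra hij
    rw [if_neg (fun h => hij (Sum.inr_injective h))] at this
    exact one_ne_zero this
  have hmono : ∀ u v : Fin l → ℕ,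
      (∏ i, x i ^ u i) * ∏ i, y i ^ v i = MvPowerSeries.monomial (bivec u v) 1 := by
    intro u v
    have hprod : ∀ (f : Fin l → Fin l ⊕ Fin l) (w : Fin l → ℕ),
        ∏ i, (MvPowerSeries.X (f i) : MvPowerSeries _ ℤ) ^ w i =
          MvPowerSeries.monomial (∑ i, Finsupp.single (f i) (w i)) 1 := by
      intro f w
      simp only [MvPowerSeries.X_pow_eq, MvPowerSeries.prod_monomial, prod_const_one]
    have hvec : (∑ i, Finsupp.single (Sum.inl i) (u i)) + ∑ i, Finsupp.single (Sum.inr i) (v i) =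
        bivec u v := by
      ext (i | i) <;> simp [bivec, Finsupp.single_apply]
    rw [hprod, hprod, MvPowerSeries.monomial_mul_monomial, one_mul, hvec]
  have hxy : ∀ i j, (1 - x i * y j) * geom ℤ (e (i, j)) = 1 := by
    intro i j
    have : x i * y j = MvPowerSeries.monomial (e (i, j)) 1 := by
      rw [← hmono]
      simp [Pi.single_apply]
    rw [this, one_sub_monomial_mul_geom (hne _)]
  have hcauchy := congrArg (fun z => z * ∏ c, geom ℤ (e c)) (det_prod_erase x hy)
  -- multiplied with the Cauchy kernel, the left side becomes `det (1 / (1 - x_i y_j))`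
  have hleft : Matrix.det (Matrix.of fun i j => ∏ m ∈ univ.erase j, (1 - x i * y m)) *
      ∏ c, geom ℤ (e c) = ∑ s : Equiv.Perm (Fin l), ((Equiv.Perm.sign s : ℤ) : MvPowerSeries _ ℤ) *
        ∏ i, geom ℤ (e (i, s i)) := by
    rw [← Matrix.det_transpose, Matrix.det_apply', sum_mul]
    refine sum_congr rfl fun s _ => ?_
    rw [mul_assoc, Fintype.prod_prod_type, ← prod_mul_distrib]
    congr 1
    refine prod_congr rfl fun i _ => ?_
    rw [Matrix.transpose_apply, Matrix.of_apply, ← mul_prod_erase univ _ (mem_univ (s i)),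
      mul_left_comm, ← prod_mul_distrib, prod_congr rfl fun j _ => hxy i j, prod_const_one, mul_one]
  have hright : (Matrix.projVandermonde 1 x).det * (Matrix.projVandermonde 1 y).det *
      ∏ c, geom ℤ (e c) = ∑ s : Equiv.Perm (Fin l), ∑ t : Equiv.Perm (Fin l),
        (((Equiv.Perm.sign s : ℤ) * (Equiv.Perm.sign t : ℤ) : ℤ) : MvPowerSeries _ ℤ) *
        (MvPowerSeries.monomial (bivec (fun i => ((s i).rev : ℕ)) (fun i => ((t i).rev : ℕ))) 1 *
          ∏ c, geom ℤ (e c)) := by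
    rw [det_projVandermonde_eq_sum, det_projVandermonde_eq_sum, sum_mul_sum, sum_mul]
    refine sum_congr rfl fun s _ => ?_
    rw [sum_mul]
    refine sum_congr rfl fun t _ => ?_
    rw [← hmono]
    push_cast
    ring
  rw [hleft, hright] at hcauchy
  have hcoeff := congrArg (MvPowerSeries.coeff (bivec U U)) hcauchy
  simp only [map_sum, ← zsmul_eq_mul, map_zsmul] at hcoeff
  simp only [e, coeff_monomial_mul_prod_geom, smul_eq_mul] at hcoeff
  -- as `U` is injective, only `s = 1` contributes to the coefficient on the left
  have hsum : ∀ (s : Equiv.Perm (Fin l)) (N : Fin l → ℕ), ∑ i, N i • e (i, s i) = bivec U U →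
      N = U ∧ s = 1 := by
    intro s N h
    have h1 : ∀ i, N i = U i := fun i => by
      have := DFunLike.congr_fun h (Sum.inl i)
      simpa [e, bivec, Finsupp.finsetSum_apply, Pi.single_apply] using this
    refine ⟨funext h1, Equiv.ext fun i => hU.injective ?_⟩
    have := DFunLike.congr_fun h (Sum.inr (s i))
    rw [Equiv.Perm.one_apply, ← h1 i]
    simpa [e, bivec, Finsupp.finsetSum_apply, Pi.single_apply] using this.symm
  rw [← hcoeff, sum_eq_single 1]
  · rw [Equiv.Perm.sign_one, coeff_prod_geom fun i => hne (i, (1 : Equiv.Perm (Fin l)) i),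
      Units.val_one, one_mul, Nat.cast_eq_one, Nat.card_eq_one_iff_unique]
    refine ⟨⟨fun N N' => Subtype.ext ?_⟩, ⟨U, ?_⟩⟩
    · rw [(hsum 1 _ N.2).1, (hsum 1 _ N'.2).1]
    · ext (i | i) <;> simp [e, bivec, Finsupp.finsetSum_apply, Pi.single_apply]
  · intro s _ hs
    rw [coeff_prod_geom fun i => hne (i, s i), Nat.card_eq_zero.2 (Or.inl ⟨fun N => ?_⟩),
      Nat.cast_zero, mul_zero]
    exact hs (hsum s _ N.2).2
  · intro h
    exact absurd (mem_univ _) h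

end Norm

/-! ### The determinantal character formula -/

section Character

variable {n : ℕ} (lam : n.Partition)

/-- The virtual character `∑_s sgn(s) M^(lam - id + s)`, the determinantal counterpart of the
character of the Specht module. -/
def detChar (g : Equiv.Perm (Fin n)) : ℤ :=
  ∑ s : Equiv.Perm (Fin (Multiset.card lam.parts)),
    (Equiv.Perm.sign s : ℤ) * (fixedCount (HasContent (shifted lam s)) g : ℤ)

/-- A multiset of pairs is the matrix of its multiplicities, whose row and column sums are the
contents of the two projections. -/
theorem card_multiset_eq_matrixCount {l : ℕ} {a b : Fin l → ℤ} (ha : ∑ i, a i = n) :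
    Nat.card {M : Multiset (Fin l × Fin l) // Multiset.card M = n ∧
      HasContent a (M.map Prod.fst) ∧ HasContent b (M.map Prod.snd)} = matrixCount a b := by
  classical
  have hfst : ∀ (M : Multiset (Fin l × Fin l)) i,
      (M.map Prod.fst).count i = ∑ j, M.count (i, j) := fun M i => by
    induction M using Multiset.induction_on with
    | empty => simp
    | cons c M ih =>
      rw [Multiset.map_cons, Multiset.count_cons, ih]
      simp only [Multiset.count_cons, sum_add_distrib, Prod.ext_iff]
      congr 1
      by_cases h : i = c.1 <;> simp [h]
  have hsnd : ∀ (M : Multiset (Fin l × Fin l)) j,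
      (M.map Prod.snd).count j = ∑ i, M.count (i, j) := fun M j => by
    induction M using Multiset.induction_on with
    | empty => simp
    | cons c M ih =>
      rw [Multiset.map_cons, Multiset.count_cons, ih]
      simp only [Multiset.count_cons, sum_add_distrib, Prod.ext_iff]
      congr 1
      by_cases h : j = c.2 <;> simp [h]
  refine Nat.card_congr (Equiv.subtypeEquiv
    (Multiset.toFinsupp.toEquiv.trans Finsupp.equivFunOnFinite) fun M => ?_)
  have hM : ∀ c, (Multiset.toFinsupp.toEquiv.trans Finsupp.equivFunOnFinite) M c = M.count c :=
    fun c => rfl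
  simp only [hM, HasContent, hfst, hsnd, Nat.cast_sum, and_iff_right_iff_imp]
  intro h
  have h1 := Multiset.sum_count_eq_card (s := univ) (m := M) fun _ _ => mem_univ _
  rw [← h1, Fintype.sum_prod_type]
  zify
  rw [← ha]
  exact sum_congr rfl fun i _ => h.1 i

/-- The determinantal virtual character has norm one: by Burnside's lemma its norm is the
alternating sum of `sum_sign_mul_matrixCount` for the strictly decreasing exponents
`lam_i + ℓ - i`. -/
theorem sum_detChar_sq : ∑ g, detChar lam g * detChar lam g = n.factorial := by
  have hU : StrictAnti fun i : Fin (Multiset.card lam.parts) =>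
      part lam ((i : ℕ) + 1) + (i.rev : ℕ) := by
    intro i j hij
    have h1 := part_antitone lam (show (i : ℕ) ≤ j from hij.le)
    have h2 : (j.rev : ℕ) < i.rev := Fin.rev_lt_rev.2 hij
    dsimp only at h1 ⊢
    lia
  have h := sum_sign_mul_matrixCount hU
  have hs : ∀ s : Equiv.Perm (Fin (Multiset.card lam.parts)),
      (fun i : Fin (Multiset.card lam.parts) =>
        ((part lam ((i : ℕ) + 1) + (i.rev : ℕ) : ℕ) : ℤ) - ((s i).rev : ℕ)) =
        shifted lam s := fun s => funext fun i => by
    have h1 := (s i).2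
    have h2 := i.2
    simp only [shifted, Fin.val_rev]
    lia
  simp only [hs] at h
  unfold detChar
  simp only [sum_mul_sum]
  rw [sum_comm]
  simp only [sum_comm (s := (univ : Finset (Equiv.Perm (Fin n))))]
  have hst : ∀ s t : Equiv.Perm (Fin (Multiset.card lam.parts)),
      ∑ g : Equiv.Perm (Fin n),
        (Equiv.Perm.sign s : ℤ) * (fixedCount (HasContent (shifted lam s)) g : ℤ) *
        ((Equiv.Perm.sign t : ℤ) * (fixedCount (HasContent (shifted lam t)) g : ℤ)) =
      (Equiv.Perm.sign s : ℤ) * (Equiv.Perm.sign t : ℤ) *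
        (matrixCount (shifted lam s) (shifted lam t) : ℤ) * n.factorial := fun s t => by
    have h1 := sum_fixedCount_mul (n := n) (HasContent (shifted lam s))
      (HasContent (shifted lam t))
    rw [card_multiset_eq_matrixCount (sum_shifted lam s)] at h1
    zify at h1
    rw [mul_assoc, ← h1, mul_sum]
    exact sum_congr rfl fun g _ => by ring
  simp only [hst]
  simp only [← sum_mul, h, one_mul]

theorem card_perm_ne_zero : (Nat.card (Equiv.Perm (Fin n)) : ℂ) ≠ 0 :=
  Nat.cast_ne_zero.2 Nat.card_pos.ne'

theorem card_perm_eq : Nat.card (Equiv.Perm (Fin n)) = n.factorial := by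
  rw [Nat.card_eq_fintype_card, Fintype.card_perm, Fintype.card_fin]

/-- Characters of symmetric groups are invariant under inversion. -/
theorem character_inv {V : Type*} [AddCommGroup V] [Module ℂ V]
    (rho : Representation ℂ (Equiv.Perm (Fin n)) V) (g : Equiv.Perm (Fin n)) :
    rho.character g⁻¹ = rho.character g := by
  obtain ⟨c, hc⟩ := isConj_iff.1
    (Equiv.Perm.isConj_iff_cycleType_eq.2 (Equiv.Perm.cycleType_inv g).symm)
  rw [← hc, char_conj]

/-- The orthogonality relations, without complex conjugation because characters of symmetric groups
are invariant under inversion. -/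
theorem sum_character_mul_character {V W : Type*} [AddCommGroup V] [Module ℂ V]
    [FiniteDimensional ℂ V] [AddCommGroup W] [Module ℂ W] [FiniteDimensional ℂ W]
    (rho : Representation ℂ (Equiv.Perm (Fin n)) V)
    (tau : Representation ℂ (Equiv.Perm (Fin n)) W) :
    ∑ g, tau.character g * rho.character g =
      n.factorial * Module.finrank ℂ (IntertwiningMap rho tau) := by
  have := invertibleOfNonzero (card_perm_ne_zero (n := n))
  have h := card_inv_mul_sum_char_mul_char_eq_finrank rho tau
  rw [← h, ← card_perm_eq, mul_inv_cancel_left₀ card_perm_ne_zero]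
  simp only [character_inv]

/-- The character of the Specht module is real: a basis can be chosen among the polytabloids, and
vectors with real entries have real coordinates in it. -/
theorem exists_real_character (g : Equiv.Perm (Fin n)) :
    ∃ x : ℝ, (spechtRep lam).character g = x := by
  have hspan : ⊤ ≤ Submodule.span ℂ (Set.range (spechtGen (lam := lam))) := by
    have h : Set.range (spechtGen (lam := lam)) =
        (fun x : Specht lam => x.1) ⁻¹' Set.range (polytabloid (lam := lam)) := by
      ext x
      exact exists_congr fun T => Subtype.ext_iff
    rw [h]
    exact (Submodule.span_span_coe_preimage (R := ℂ) (s := Set.range (polytabloid (lam := lam)))).ge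
  let b := Module.Basis.ofSpan hspan
  have hb : ∀ i, ∃ T, b i = spechtGen T := fun i => by
    obtain ⟨T, hT⟩ := Module.Basis.ofSpan_subset hspan (Set.mem_range_self i)
    exact ⟨T, hT.symm⟩
  have hreal : ∀ (T : Tableau lam) (f : Fin n → ℕ), (polytabloid T f).im = 0 := by
    intro T f
    rw [polytabloid_apply, Complex.im_sum]
    refine sum_eq_zero fun s _ => ?_
    split_ifs <;> simp
  have := FiniteDimensional.fintypeBasisIndex b
  have hcoord : ∀ (T : Tableau lam) i, (b.repr (spechtGen T) i).im = 0 := by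
    intro T i
    -- the imaginary parts of the coordinates are the coordinates of the imaginary part `0`
    have h0 : ∑ i, ((b.repr (spechtGen T) i).im : ℂ) • b i = 0 := by
      refine Subtype.ext (Finsupp.ext fun f => Complex.ext ?_ ?_)
      all_goals
        have h1 : ∀ c : _ → ℂ, ((∑ i, c i • b i : Specht lam)).1 f = ∑ i, c i * (b i).1 f := by
          intro c
          have : ((∑ i, c i • b i : Specht lam)).1 = ∑ i, c i • (b i).1 :=
            map_sum (spechtSub lam).toSubmodule.subtype (fun i => c i • b i) univ
          rw [this, Finsupp.finsetSum_apply]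
          rfl
        rw [h1]
        have h2 : ∀ i, ((b i).1 f).im = 0 := fun i => by
          obtain ⟨T', hT'⟩ := hb i
          rw [hT']
          exact hreal T' f
      · have h3 := congrArg Complex.im (h1 fun i => b.repr (spechtGen T) i)
        rw [b.sum_repr, Complex.im_sum] at h3
        rw [Complex.re_sum]
        refine Eq.trans ?_ (h3.symm.trans (hreal T f))
        refine sum_congr rfl fun i _ => ?_
        simp [Complex.mul_re, Complex.mul_im, h2]
      · rw [Complex.im_sum]
        refine sum_eq_zero fun i _ => ?_
        simp [Complex.mul_im, h2]
    exact_mod_cast Fintype.linearIndependent_iff.1 b.linearIndependent _ h0 i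
  classical
  refine ⟨((spechtRep lam).character g).re, Complex.ext rfl ?_⟩
  rw [character, LinearMap.trace_eq_matrix_trace ℂ b, Matrix.trace, Complex.im_sum,
    Complex.ofReal_im]
  refine sum_eq_zero fun i _ => ?_
  obtain ⟨T, hT⟩ := hb i
  rw [Matrix.diag_apply, LinearMap.toMatrix_apply, hT]
  have : spechtRep lam g (spechtGen T) = spechtGen (g.symm.trans T : Tableau lam) :=
    Subtype.ext (rowRep_polytabloid T g)
  rw [this, hcoord]

/-- **Determinantal formula** for the character of the Specht module. Both sides have norm one and
scalar product one, so that their difference has norm zero. -/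
theorem character_spechtRep (g : Equiv.Perm (Fin n)) :
    (spechtRep lam).character g = detChar lam g := by
  have hcross : ∑ g, (detChar lam g : ℂ) * (spechtRep lam).character g = n.factorial := by
    unfold detChar
    push_cast
    simp only [sum_mul]
    rw [sum_comm]
    have hs : ∀ s : Equiv.Perm (Fin (Multiset.card lam.parts)),
        ∑ g : Equiv.Perm (Fin n), ((Equiv.Perm.sign s : ℤ) : ℂ) *
          (fixedCount (HasContent (shifted lam s)) g : ℂ) * (spechtRep lam).character g =
        if s = 1 then (n.factorial : ℂ) else 0 := fun s => by
      have h := sum_character_mul_character (spechtRep lam)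
        (wordRep n (HasContent (shifted lam s)))
      rw [finrank_specht_wordRep] at h
      simp only [character_wordRep] at h
      simp only [mul_assoc]
      rw [← mul_sum, h]
      split_ifs with h1
      · simp [h1]
      · simp
    rw [sum_congr rfl fun s _ => hs s, sum_ite_eq' univ 1, if_pos (mem_univ _)]
  have hself : ∑ g, (spechtRep lam).character g * (spechtRep lam).character g = n.factorial := by
    rw [sum_character_mul_character, finrank_end_specht, Nat.cast_one, mul_one]
  have hdet : ∑ g, (detChar lam g : ℂ) * detChar lam g = n.factorial := by
    exact_mod_cast congrArg (Int.cast : ℤ → ℂ) (sum_detChar_sq lam)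
  choose x hx using exists_real_character lam
  have hzero : ∑ g, (x g - detChar lam g) ^ 2 = 0 := by
    have : ((∑ g, (x g - detChar lam g) ^ 2 : ℝ) : ℂ) = 0 := by
      push_cast
      simp only [← hx, sub_sq, sum_add_distrib, sum_sub_distrib]
      simp only [pow_two, hself, hdet, mul_assoc, ← mul_sum]
      simp only [mul_comm ((spechtRep lam).character _), hcross]
      ring
    exact_mod_cast this
  have := (sum_eq_zero_iff_of_nonneg fun g _ => sq_nonneg (x g - detChar lam g)).1 hzero g
    (mem_univ g)
  rw [hx, sub_eq_zero.1 (pow_eq_zero_iff two_ne_zero |>.1 this)]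
  norm_cast

end Character

/-! ### Words of monomials -/

section Monomials

variable {n k : ℕ}

/-- The condition that the monomials in a multiset, encoded by their exponents, have total
degree `r`. -/
def HasDegree {k : ℕ} (r : ℕ) (M : Multiset (Fin k →₀ ℕ)) : Prop :=
  (M.map Finsupp.degree).sum = r

theorem hasDegree_map_univ (g : Fin n → Fin k →₀ ℕ) (r : ℕ) :
    HasDegree r (univ.val.map g) ↔ ∑ a, (g a).degree = r := by
  rw [HasDegree, Multiset.map_map]
  rfl

/-- A monomial in the variables `x_{a,j}` is a word of `n` monomials in `k` variables. -/
def monomialWordEquiv (n k : ℕ) : (Fin n × Fin k →₀ ℕ) ≃ (Fin n → Fin k →₀ ℕ) :=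
  Finsupp.curryEquiv.trans Finsupp.equivFunOnFinite

theorem monomialWordEquiv_apply (d : Fin n × Fin k →₀ ℕ) (a : Fin n) (j : Fin k) :
    monomialWordEquiv n k d a j = d (a, j) := rfl

theorem sum_degree_monomialWordEquiv (d : Fin n × Fin k →₀ ℕ) :
    ∑ a, (monomialWordEquiv n k d a).degree = d.degree := by
  simp only [Finsupp.degree_eq_sum, monomialWordEquiv_apply, Fintype.sum_prod_type]

theorem monomialWordEquiv_mapDomain (s : Equiv.Perm (Fin n)) (d : Fin n × Fin k →₀ ℕ) :
    monomialWordEquiv n k (d.mapDomain (Prod.map ⇑s id)) = monomialWordEquiv n k d ∘ ⇑s⁻¹ := by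
  funext a
  ext j
  rw [monomialWordEquiv_apply, Function.comp_apply, monomialWordEquiv_apply]
  have h : Function.Injective (Prod.map ⇑s (id : Fin k → Fin k)) :=
    Function.Injective.prodMap s.injective Function.injective_id
  rw [← Finsupp.mapDomain_apply h d]
  simp

instance (r : ℕ) : Finite (Word n (HasDegree (k := k) r)) := by
  have := (Finsupp.finite_of_degree_eq (σ := Fin n × Fin k) r).to_subtype
  refine Finite.of_injective (β := {d : Fin n × Fin k →₀ ℕ | d.degree = r})
    (fun w => ⟨(monomialWordEquiv n k).symm w.1, ?_⟩) fun w w' h => ?_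
  · have h := (hasDegree_map_univ _ _).1 w.2
    rw [← Equiv.apply_symm_apply (monomialWordEquiv n k) w.1, sum_degree_monomialWordEquiv] at h
    exact h
  · exact Subtype.ext ((monomialWordEquiv n k).symm.injective (congrArg Subtype.val h))

/-- The basis of monomials of the homogeneous polynomials. -/
def homPolyBasis (r k n : ℕ) :
    Module.Basis {d : Fin n × Fin k →₀ ℕ | d.degree = r} ℂ (HomPoly r k n) :=
  (MvPolynomial.basisRestrictSupport ℂ _).map (LinearEquiv.ofEq _ _
    (MvPolynomial.homogeneousSubmodule_eq_finsupp_supported (Fin n × Fin k) ℂ r).symm)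

theorem coe_homPolyBasis (r : ℕ) (d : {d : Fin n × Fin k →₀ ℕ | d.degree = r}) :
    (homPolyBasis r k n d).1 = MvPolynomial.monomial d.1 1 := by
  have h : homPolyBasis r k n d = ⟨MvPolynomial.monomial d.1 1,
      MvPolynomial.isHomogeneous_monomial _ d.2⟩ := by
    refine Module.Basis.apply_eq_iff.2 (Finsupp.ext fun d' => ?_)
    change MvPolynomial.coeff d'.1 (MvPolynomial.monomial d.1 (1 : ℂ)) = _
    classical
    rw [MvPolynomial.coeff_monomial, Finsupp.single_apply]
    simp only [Subtype.ext_iff]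
  rw [h]

instance (r : ℕ) : Finite {d : Fin n × Fin k →₀ ℕ | d.degree = r} :=
  (Finsupp.finite_of_degree_eq r).to_subtype

instance (r : ℕ) : FiniteDimensional ℂ (HomPoly r k n) :=
  Module.Finite.of_basis (homPolyBasis r k n)

/-- The monomials are a basis permuted by the symmetric group; they are the words of monomials. -/
theorem character_homPolyRep (r : ℕ) (s : Equiv.Perm (Fin n)) :
    (homPolyRep r k n).character s = fixedCount (HasDegree (k := k) r) s := by
  rw [character, trace_of_basis_map (homPolyBasis r k n) _
    (fun d => ⟨d.1.mapDomain (Prod.map ⇑s id), by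
      rw [Set.mem_ofPred_eq, Finsupp.degree_mapDomain]
      exact d.2⟩) (fun d => Subtype.ext ?_)]
  · congr 1
    refine Nat.card_congr (((Equiv.subtypeSubtypeEquivSubtypeExists _ _).trans
      (Equiv.subtypeEquiv (monomialWordEquiv n k) fun d => ?_)))
    rw [hasDegree_map_univ, sum_degree_monomialWordEquiv, ← comp_inv_eq_iff,
      ← monomialWordEquiv_mapDomain, (monomialWordEquiv n k).injective.eq_iff]
    constructor
    · rintro ⟨h1, h2⟩
      exact ⟨h1, congrArg Subtype.val h2⟩
    · rintro ⟨h1, h2⟩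
      exact ⟨h1, Subtype.ext h2⟩
  · rw [coe_homPolyBasis]
    change MvPolynomial.rename _ (homPolyBasis r k n d).1 = _
    rw [coe_homPolyBasis, MvPolynomial.rename_monomial]

end Monomials

/-! ### Generating series of multisets of monomials -/

section Generating

variable {n l k : ℕ}

/-- The generating series, by total degree, of the multisets of `m` monomials in `k` variables; it
is `0` if `m` is negative. -/
def multisetSeries (k : ℕ) (m : ℤ) : PowerSeries ℚ :=
  PowerSeries.mk fun r =>
    (Nat.card {M : Multiset (Fin k →₀ ℕ) // (Multiset.card M : ℤ) = m ∧ HasDegree r M} : ℚ)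

/-- A family of multisets indexed by `Fin l` as a multiset of pairs. -/
def unionMultisets (l : ℕ) (A : Type*) : (Fin l → Multiset A) →+ Multiset (Fin l × A) :=
  ∑ i, (Multiset.mapAddMonoidHom (Prod.mk i)).comp (Pi.evalAddMonoidHom _ i)

theorem unionMultisets_apply {A : Type*} (N : Fin l → Multiset A) :
    unionMultisets l A N = ∑ i, (N i).map (Prod.mk i) := by
  simp [unionMultisets]

theorem map_fst_unionMultisets {A : Type*} (N : Fin l → Multiset A) (i : Fin l) :
    ((unionMultisets l A N).map Prod.fst).count i = Multiset.card (N i) := by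
  rw [unionMultisets_apply, ← Multiset.coe_mapAddMonoidHom, map_sum, Multiset.count_sum']
  simp [Multiset.count_replicate]

theorem map_snd_unionMultisets {A : Type*} (N : Fin l → Multiset A) :
    (unionMultisets l A N).map Prod.snd = ∑ i, N i := by
  rw [unionMultisets_apply, ← Multiset.coe_mapAddMonoidHom, map_sum]
  simp

/-- A multiset of pairs is the same as the family of its fibres over the first component. -/
theorem unionMultisets_bijective (l : ℕ) (A : Type*) :
    Function.Bijective (unionMultisets l A) := by
  classical
  constructor
  · intro N N' h
    funext i
    have key : ∀ N : Fin l → Multiset A,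
        ((unionMultisets l A N).filter fun c => c.1 = i).map Prod.snd = N i := by
      intro N
      have hf : ∀ S : Finset (Fin l), (∑ j ∈ S, (N j).map (Prod.mk j)).filter (fun c => c.1 = i) =
          ∑ j ∈ S, ((N j).map (Prod.mk j)).filter fun c => c.1 = i := fun S => by
        induction S using Finset.induction_on with
        | empty => simp
        | insert j S hj ih => rw [sum_insert hj, sum_insert hj, Multiset.filter_add, ih]
      rw [unionMultisets_apply, hf, ← Multiset.coe_mapAddMonoidHom, map_sum, sum_eq_single i]
      · simp [Multiset.filter_map]
      · intro j _ hj
        simp [Multiset.filter_map, hj]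
      · simp
    rw [← key N, h, key N']
  · intro M
    induction M using Multiset.induction_on with
    | empty => exact ⟨0, map_zero _⟩
    | cons c M ih =>
      obtain ⟨N, rfl⟩ := ih
      refine ⟨Pi.single c.1 {c.2} + N, ?_⟩
      rw [map_add, ← Multiset.singleton_add]
      congr 1
      rw [unionMultisets_apply, sum_eq_single c.1]
      · simp
      · intro j _ hj
        simp [hj]
      · simp

theorem finite_multiset_hasDegree (m : ℤ) (r : ℕ) :
    Finite {M : Multiset (Fin k →₀ ℕ) // (Multiset.card M : ℤ) = m ∧ HasDegree r M} := by
  have := Finite.of_equiv _ (orbitEquiv (n := m.toNat) (HasDegree (k := k) r))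
  refine Finite.of_injective (β := {M : Multiset (Fin k →₀ ℕ) //
    Multiset.card M = m.toNat ∧ HasDegree r M}) (fun M => ⟨M.1, ?_, M.2.2⟩) fun M M' h => ?_
  · have := M.2.1
    lia
  · exact Subtype.ext (by simpa using h)

theorem hasDegree_sum (N : Fin l → Multiset (Fin k →₀ ℕ)) (r : ℕ) :
    HasDegree r (∑ i, N i) ↔ ∑ i, ((N i).map Finsupp.degree).sum = r := by
  rw [HasDegree, ← Multiset.coe_mapAddMonoidHom, map_sum, ← Multiset.coe_sumAddMonoidHom, map_sum]

/-- The number of orbits on pairs of a word of content `a` and a monomial of degree `r`. -/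
theorem card_multiset_eq_coeff_prod {a : Fin l → ℤ} (ha : ∑ i, a i = n) (r : ℕ) :
    (Nat.card {M : Multiset (Fin l × (Fin k →₀ ℕ)) // Multiset.card M = n ∧
      HasContent a (M.map Prod.fst) ∧ HasDegree r (M.map Prod.snd)} : ℚ) =
      PowerSeries.coeff r (∏ i, multisetSeries k (a i)) := by
  classical
  have h1 : Nat.card {M : Multiset (Fin l × (Fin k →₀ ℕ)) // Multiset.card M = n ∧
      HasContent a (M.map Prod.fst) ∧ HasDegree r (M.map Prod.snd)} =
      Nat.card {N : Fin l → Multiset (Fin k →₀ ℕ) // (∀ i, (Multiset.card (N i) : ℤ) = a i) ∧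
        ∑ i, ((N i).map Finsupp.degree).sum = r} := by
    refine (Nat.card_congr (Equiv.subtypeEquiv
      (Equiv.ofBijective _ (unionMultisets_bijective l (Fin k →₀ ℕ))) fun N => ?_)).symm
    rw [Equiv.ofBijective_apply, map_snd_unionMultisets, hasDegree_sum]
    simp only [HasContent, map_fst_unionMultisets]
    refine ⟨fun h => ⟨?_, h⟩, fun h => h.2⟩
    rw [unionMultisets_apply, Multiset.card_sum]
    zify
    rw [← ha]
    exact sum_congr rfl fun i _ => by rw [Multiset.card_map, h.1 i]
  rw [h1, PowerSeries.coeff_prod]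
  simp only [multisetSeries, PowerSeries.coeff_mk]
  have := fun (f : Fin l →₀ ℕ) i => finite_multiset_hasDegree (k := k) (a i) (f i)
  rw [← sum_coe_sort]
  simp only [← Nat.cast_prod, ← Nat.card_pi]
  rw [← Nat.cast_sum, ← Nat.card_sigma]
  refine congrArg _ (Nat.card_congr (Equiv.ofBijective (fun x => ⟨fun i => (x.2 i).1,
    fun i => (x.2 i).2.1, ?_⟩) ⟨?_, ?_⟩)).symm
  rotate_left 2
  · have h := (mem_finsuppAntidiag.1 x.1.2).1
    exact (sum_congr rfl fun i _ => (x.2 i).2.2).trans h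
  · rintro ⟨⟨f, hf⟩, N⟩ ⟨⟨f', hf'⟩, N'⟩ h
    have hN : ∀ i, (N i).1 = (N' i).1 := fun i => congrFun (congrArg Subtype.val h) i
    obtain rfl : f = f' := Finsupp.ext fun i => by
      rw [← (N i).2.2, ← (N' i).2.2, hN]
    obtain rfl : N = N' := funext fun i => Subtype.ext (hN i)
    rfl
  · rintro ⟨N, hN, hr⟩
    exact ⟨⟨⟨Finsupp.equivFunOnFinite.symm fun i => ((N i).map Finsupp.degree).sum,
      mem_finsuppAntidiag.2 ⟨hr, subset_univ _⟩⟩, fun i => ⟨N i, hN i, rfl⟩⟩, rfl⟩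

end Generating

/-! ### Cycle types and complete symmetric functions -/

section CycleType

variable {m : ℕ}

/-- The orbits (cycles, including the trivial ones) of a permutation. -/
abbrev CycleClass (s : Equiv.Perm (Fin m)) : Type := Quotient (Equiv.Perm.SameCycle.setoid s)

/-- The number of elements of a cycle. -/
def cycleSize {s : Equiv.Perm (Fin m)} (o : CycleClass s) : ℕ :=
  Nat.card {a // (Quotient.mk _ a : CycleClass s) = o}

theorem cycleSize_pos {s : Equiv.Perm (Fin m)} (o : CycleClass s) : 0 < cycleSize o := by
  obtain ⟨a, rfl⟩ := Quotient.exists_rep o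
  have : Nonempty {b // (Quotient.mk _ b : CycleClass s) = Quotient.mk _ a} := ⟨⟨a, rfl⟩⟩
  exact Nat.card_pos

open Classical in
/-- The parts of the cycle type of a permutation, fixed points included, are the sizes of its
orbits. -/
theorem parts_partition_eq (s : Equiv.Perm (Fin m)) :
    s.partition.parts = (univ : Finset (CycleClass s)).val.map cycleSize := by
  have hmem : ∀ a b : Fin m, (Quotient.mk _ b : CycleClass s) = Quotient.mk _ a ↔ s.SameCycle b a :=
    fun a b => Quotient.eq
  have hmoved : ∀ a, s a ≠ a →
      cycleSize (Quotient.mk _ a : CycleClass s) = #(s.cycleOf a).support := by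
    intro a ha
    rw [cycleSize, Nat.card_eq_fintype_card, Fintype.card_subtype]
    congr 1
    ext b
    rw [mem_filter, hmem, Equiv.Perm.mem_support_cycleOf_iff' ha, Equiv.Perm.sameCycle_comm]
    simp
  have hfixed : ∀ a, s a = a → cycleSize (Quotient.mk _ a : CycleClass s) = 1 := by
    intro a ha
    rw [cycleSize, Nat.card_eq_one_iff_unique]
    refine ⟨⟨fun b c => Subtype.ext ?_⟩, ⟨a, rfl⟩⟩
    have hb := (hmem _ _).1 b.2
    have hc := (hmem _ _).1 c.2
    rw [hb.eq_of_right ha, hc.eq_of_right ha]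
  have hout : ∀ o : CycleClass s, (Quotient.mk _ o.out : CycleClass s) = o := Quotient.out_eq
  rw [← Multiset.filter_add_not (fun o : CycleClass s => s o.out ≠ o.out) univ.val,
    Multiset.map_add, Equiv.Perm.parts_partition]
  congr 1
  · have himage : s.cycleFactorsFinset = (univ.filter fun o : CycleClass s => s o.out ≠ o.out).image
        fun o => s.cycleOf o.out := by
      ext c
      simp only [mem_image, mem_filter, mem_univ, true_and]
      constructor
      · intro hc
        obtain ⟨a, ha⟩ := Equiv.Perm.IsCycle.nonempty_support
          (Equiv.Perm.mem_cycleFactorsFinset_iff.1 hc).1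
        have hcyc := Equiv.Perm.cycle_is_cycleOf ha hc
        have hsame : s.SameCycle (Quotient.mk _ a : CycleClass s).out a := (hmem _ _).1 (hout _)
        refine ⟨Quotient.mk _ a, ?_, by rw [hsame.cycleOf_eq, hcyc]⟩
        intro h
        have := Equiv.Perm.mem_cycleFactorsFinset_support_le hc ha
        exact Equiv.Perm.mem_support.1 this (hsame.apply_eq_self_iff.1 h)
      · rintro ⟨o, ho, rfl⟩
        exact Equiv.Perm.cycleOf_mem_cycleFactorsFinset_iff.2 (Equiv.Perm.mem_support.2 ho)
    rw [Equiv.Perm.cycleType_def, himage, image_val_of_injOn, Multiset.map_map]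
    · refine Multiset.map_congr rfl fun o ho => ?_
      conv_rhs => rw [← hout o]
      rw [hmoved _ (Multiset.mem_filter.1 ho).2]
      rfl
    · intro o ho o' _ h
      have ho' : s o.out ≠ o.out := (mem_filter.1 ho).2
      have h1 : o.out ∈ (s.cycleOf o.out).support :=
        (Equiv.Perm.mem_support_cycleOf_iff' ho').2 (Equiv.Perm.SameCycle.refl _ _)
      rw [show s.cycleOf o.out = s.cycleOf o'.out from h, Equiv.Perm.mem_support_cycleOf_iff] at h1
      rw [← hout o, ← hout o', hmem]
      exact h1.1.symm
  · symm
    rw [Multiset.eq_replicate]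
    refine ⟨?_, fun c hc => ?_⟩
    · rw [Multiset.card_map, ← card_compl]
      symm
      refine card_bij (t := univ.filter fun o : CycleClass s => ¬ s o.out ≠ o.out)
        (fun a _ => Quotient.mk _ a) (fun a ha => ?_) (fun a ha b hb h => ?_) fun o ho => ?_
      · have hsame : s.SameCycle (Quotient.mk _ a : CycleClass s).out a := (hmem _ _).1 (hout _)
        simp only [mem_compl, Equiv.Perm.notMem_support] at ha
        simpa using hsame.apply_eq_self_iff.2 ha
      · simp only [mem_compl, Equiv.Perm.notMem_support] at hb
        exact ((hmem _ _).1 h).eq_of_right hb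
      · refine ⟨o.out, ?_, hout o⟩
        simpa using ho
    · obtain ⟨o, ho, rfl⟩ := Multiset.mem_map.1 hc
      rw [← hout o]
      exact hfixed _ (not_not.1 (Multiset.mem_filter.1 ho).2)

/-- The conjugacy class of cycle type `mu` has `m! / z_mu` elements. -/
theorem card_partition_eq_mul_zNumber (mu : m.Partition) :
    #{s : Equiv.Perm (Fin m) | s.partition.parts = mu.parts} * zNumber mu = m.factorial := by
  set c := mu.parts.filter (2 ≤ ·) with hc
  have hparts : mu.parts = c + Multiset.replicate (mu.parts.count 1) 1 := by
    ext i
    rw [Multiset.count_add, Multiset.count_replicate, hc, Multiset.count_filter]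
    have h0 : mu.parts.count 0 = 0 :=
      Multiset.count_eq_zero.2 fun h => lt_irrefl _ (mu.parts_pos h)
    rcases lt_trichotomy i 1 with h | h | h
    · obtain rfl : i = 0 := by lia
      simp [h0]
    · subst h
      simp
    · rw [if_pos (show 2 ≤ i from h), if_neg (by lia), add_zero]
  have hsum : c.sum + mu.parts.count 1 = m := by
    have := congrArg Multiset.sum hparts
    rw [mu.parts_sum, Multiset.sum_add, Multiset.sum_replicate, smul_eq_mul, mul_one] at this
    exact this.symm
  have h := Equiv.Perm.card_of_cycleType_mul_eq (Fin m) c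
  rw [if_pos ⟨by rw [Fintype.card_fin]; lia, fun a ha => (Multiset.mem_filter.1 ha).2⟩,
    Fintype.card_fin] at h
  rw [← h]
  congr 1
  · congr 1
    ext s
    simp only [mem_filter, mem_univ, true_and]
    constructor
    · intro hs
      rw [← Equiv.Perm.filter_parts_partition_eq_cycleType, hs]
    · intro hs
      have h1 := s.partition.parts_sum
      rw [Equiv.Perm.parts_partition, Multiset.sum_add, Multiset.sum_replicate, smul_eq_mul,
        mul_one, hs, Fintype.card_fin] at h1
      rw [Equiv.Perm.parts_partition, hs, Fintype.card_fin]
      conv_rhs => rw [hparts]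
      congr 2
      lia
  · have hcount : ∀ i ∈ c.toFinset, c.count i = mu.parts.count i := fun i hi => by
      rw [hc, Multiset.count_filter, if_pos (Multiset.mem_filter.1 (Multiset.mem_toFinset.1 hi)).2]
    have hprod : c.prod = ∏ i ∈ mu.parts.toFinset, i ^ mu.parts.count i := by
      rw [← Finset.prod_multiset_count]
      conv_rhs => rw [hparts, Multiset.prod_add, Multiset.prod_replicate, one_pow, mul_one]
    have h1c : 1 ∉ c.toFinset := fun h => by
      have := (Multiset.mem_filter.1 (Multiset.mem_toFinset.1 h)).2
      lia
    have hfact : (∏ i ∈ mu.parts.toFinset, (mu.parts.count i).factorial) =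
        (m - c.sum).factorial * ∏ i ∈ c.toFinset, (c.count i).factorial := by
      rw [show m - c.sum = mu.parts.count 1 by lia, prod_congr (s₁ := c.toFinset) rfl
        fun i hi => congrArg Nat.factorial (hcount i hi),
        ← prod_insert (f := fun i => (mu.parts.count i).factorial) h1c]
      refine prod_subset (fun i hi => ?_) fun i _ hi => ?_
      · rw [Multiset.mem_toFinset] at hi
        rw [mem_insert, Multiset.mem_toFinset, hc, Multiset.mem_filter]
        have := mu.parts_pos hi
        by_cases h : i = 1
        · exact Or.inl h
        · exact Or.inr ⟨hi, by lia⟩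
      · rw [Multiset.count_eq_zero.2 fun h => hi (Multiset.mem_toFinset.2 h), Nat.factorial_zero]
    rw [zNumber, prod_mul_distrib, hfact, hprod]
    ring

end CycleType

section Plethysm

variable {m k : ℕ}

/-- The value `1 / (1 - q^c)^k` of `p_c` in the plethysm, as a product of `k` geometric series. -/
theorem expand_inv_one_sub_X_pow {c : ℕ} (hc : c ≠ 0) :
    PowerSeries.expand c hc (((1 - PowerSeries.X) ^ k)⁻¹ : PowerSeries ℚ) =
      ∏ _j : Fin k, (geom ℚ (Finsupp.single () c) : PowerSeries ℚ) := by
  have h1 : ((1 - PowerSeries.X) ^ k : PowerSeries ℚ) * ((1 - PowerSeries.X) ^ k)⁻¹ = 1 :=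
    PowerSeries.mul_inv_cancel _ (by simp)
  have h2 := congrArg (PowerSeries.expand c hc) h1
  rw [map_mul, map_pow, map_sub, map_one, PowerSeries.expand_X] at h2
  have h3 : (1 - PowerSeries.X ^ c : PowerSeries ℚ) * geom ℚ (Finsupp.single () c) = 1 := by
    rw [PowerSeries.X_pow_eq]
    exact one_sub_monomial_mul_geom (by simpa using hc)
  rw [prod_const, card_univ, Fintype.card_fin]
  have h4 : (1 - PowerSeries.X ^ c : PowerSeries ℚ) ^ k *
      (geom ℚ (Finsupp.single () c) : PowerSeries ℚ) ^ k = 1 := by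
    rw [← mul_pow, h3, one_pow]
  exact left_inv_eq_right_inv ((mul_comm _ _).trans h2) h4

/-- Words fixed by a permutation are constant on its cycles, so they are counted by a product
over the cycles. -/
theorem fixedCount_hasDegree_eq_coeff (s : Equiv.Perm (Fin m)) (r : ℕ) :
    (fixedCount (HasDegree (k := k) r) s : ℚ) =
      PowerSeries.coeff r ((s.partition.parts.map fun c =>
        ∏ _j : Fin k, (geom ℚ (Finsupp.single () c) : PowerSeries ℚ)).prod) := by
  classical
  rw [parts_partition_eq, Multiset.map_map]
  have h1 : (Multiset.map ((fun c => ∏ _j : Fin k,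
      (geom ℚ (Finsupp.single () c) : PowerSeries ℚ)) ∘ cycleSize)
        (univ : Finset (CycleClass s)).val).prod =
      ∏ c : CycleClass s × Fin k, (geom ℚ (Finsupp.single () (cycleSize c.1)) : PowerSeries ℚ) := by
    rw [Fintype.prod_prod_type]
    rfl
  rw [h1]
  have h2 := coeff_prod_geom (R := ℚ) (ι := CycleClass s × Fin k)
    (e := fun c => Finsupp.single () (cycleSize c.1))
    (fun c => by simpa using (cycleSize_pos c.1).ne') (Finsupp.single () r)
  refine Eq.trans ?_ h2.symm
  rw [fixedCount]
  congr 1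
  symm
  -- the word that is constant on cycles, with the exponent `N (o, j)` of the variable `j` on `o`
  let word : (CycleClass s × Fin k → ℕ) → Fin m → Fin k →₀ ℕ := fun N a =>
    Finsupp.equivFunOnFinite.symm fun j => N (Quotient.mk _ a, j)
  have hdeg : ∀ N : CycleClass s × Fin k → ℕ,
      HasDegree r (univ.val.map (word N)) ↔
        ∑ c, N c • Finsupp.single () (cycleSize c.1) = Finsupp.single () r := by
    intro N
    have h3 : ∑ a, (word N a).degree = ∑ c : CycleClass s × Fin k, N c * cycleSize c.1 := by
      rw [Fintype.sum_prod_type, ← sum_fiberwise univ (fun a => (Quotient.mk _ a : CycleClass s))]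
      refine sum_congr rfl fun o _ => ?_
      rw [sum_congr rfl (g := fun _ => ∑ j, N (o, j)), sum_const, smul_eq_mul, mul_comm, sum_mul]
      · refine sum_congr rfl fun j _ => congrArg _ ?_
        rw [cycleSize, Nat.card_eq_fintype_card, Fintype.card_subtype]
      · intro a ha
        rw [Finsupp.degree_eq_sum, ← (mem_filter.1 ha).2]
        rfl
    rw [hasDegree_map_univ, h3]
    simp only [Finsupp.smul_single, smul_eq_mul, ← Finsupp.single_finsetSum]
    exact (Finsupp.single_injective ()).eq_iff.symm
  have hfix : ∀ N, word N ∘ s = word N := fun N => funext fun a => by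
    have : (Quotient.mk _ (s a) : CycleClass s) = Quotient.mk _ a :=
      Quotient.sound (Equiv.Perm.sameCycle_apply_left.2 (Equiv.Perm.SameCycle.refl _ _))
    simp only [word, Function.comp_apply, this]
  refine Nat.card_congr (Equiv.ofBijective (fun N => ⟨word N.1, (hdeg N.1).2 N.2, hfix N.1⟩)
    ⟨?_, ?_⟩)
  · intro N N' h
    refine Subtype.ext (funext fun ⟨o, j⟩ => ?_)
    obtain ⟨a, rfl⟩ := Quotient.exists_rep o
    exact DFunLike.congr_fun (congrFun (congrArg Subtype.val h) a) j
  · rintro ⟨g, hg, hgs⟩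
    have hconst : ∀ a b, s.SameCycle a b → g a = g b := by
      have hnat : ∀ (i : ℕ) a, g ((s ^ i) a) = g a := by
        intro i
        induction i with
        | zero => simp
        | succ i ih =>
          intro a
          rw [pow_succ, Equiv.Perm.mul_apply, ih]
          exact congrFun hgs a
      intro a b hab
      obtain ⟨i, -, hi⟩ := hab.exists_pow_eq''
      rw [← hi.2, hnat]
    have hword : word (fun c => Quotient.lift g hconst c.1 c.2) = g := by
      funext a
      ext j
      rfl
    refine ⟨⟨fun c => Quotient.lift g hconst c.1 c.2, (hdeg _).1 ?_⟩, Subtype.ext hword⟩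
    rw [hword]
    exact hg

/-- The plethystic evaluation of `h_m` counts multisets of `m` monomials. -/
theorem plethysm_hsymm (m k : ℕ) :
    plethysm (hsymm m) ((1 - PowerSeries.X) ^ k)⁻¹ = multisetSeries k m := by
  ext r
  have hB := sum_fixedCount (n := m) (HasDegree (k := k) r)
  rw [multisetSeries, PowerSeries.coeff_mk]
  simp only [Nat.cast_inj]
  have hm : (m.factorial : ℚ) ≠ 0 := Nat.cast_ne_zero.2 (Nat.factorial_ne_zero m)
  apply mul_right_cancel₀ hm
  rw [← Nat.cast_mul, ← hB, Nat.cast_sum, plethysm, hsymm, map_sum, map_sum, sum_mul]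
  -- the term of `mu` in `h_m` collects the permutations of cycle type `mu`
  have hterm : ∀ mu : m.Partition, PowerSeries.coeff r (MvPolynomial.aeval
      (fun i : ℕ+ => PowerSeries.expand (i : ℕ) i.ne_zero ((1 - PowerSeries.X) ^ k)⁻¹)
      (MvPolynomial.C (zNumber mu : ℚ)⁻¹ * (mu.parts.map psum).prod)) * m.factorial =
      ∑ s : Equiv.Perm (Fin m) with s.partition.parts = mu.parts,
        (fixedCount (HasDegree (k := k) r) s : ℚ) := by
    intro mu
    have h1 : MvPolynomial.aeval
        (fun i : ℕ+ =>
          PowerSeries.expand (i : ℕ) i.ne_zero ((1 - PowerSeries.X) ^ k : PowerSeries ℚ)⁻¹)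
        (mu.parts.map psum).prod = (mu.parts.map fun c =>
        ∏ _j : Fin k, (geom ℚ (Finsupp.single () c) : PowerSeries ℚ)).prod := by
      rw [map_multiset_prod, Multiset.map_map]
      congr 1
      refine Multiset.map_congr rfl fun c hc => ?_
      have hc0 := mu.parts_pos hc
      rw [Function.comp_apply, psum, MvPolynomial.aeval_X, expand_inv_one_sub_X_pow]
      simp only [Nat.toPNat'_coe, if_pos hc0]
    have h2 := card_partition_eq_mul_zNumber mu
    have hz : (zNumber mu : ℚ) ≠ 0 := by
      rintro h
      rw [Nat.cast_eq_zero] at h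
      rw [h, mul_zero] at h2
      exact Nat.factorial_ne_zero m h2.symm
    rw [map_mul, h1, MvPolynomial.aeval_C, ← Algebra.smul_def, PowerSeries.coeff_smul, ← h2,
      sum_congr rfl (g := fun _ => PowerSeries.coeff r ((mu.parts.map fun c =>
        ∏ _j : Fin k, (geom ℚ (Finsupp.single () c) : PowerSeries ℚ)).prod))]
    · rw [sum_const, nsmul_eq_mul, smul_eq_mul]
      push_cast
      field_simp
    · intro s hs
      rw [fixedCount_hasDegree_eq_coeff, (mem_filter.1 hs).2]
  rw [sum_congr rfl fun mu _ => hterm mu]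
  rw [← sum_fiberwise univ (fun s : Equiv.Perm (Fin m) => (⟨s.partition.parts,
    s.partition.parts_pos, s.partition.parts_sum.trans (Fintype.card_fin m)⟩ : m.Partition))]
  refine sum_congr rfl fun mu _ => sum_congr ?_ fun _ _ => rfl
  ext s
  simp only [mem_filter, mem_univ, true_and, Nat.Partition.ext_iff]

end Plethysm

/-! ### The dimension formula -/

section Dimension

variable {n : ℕ} (r k : ℕ) (lam : n.Partition)

theorem plethysm_hsymmInt (m : ℤ) :
    plethysm (hsymmInt m) ((1 - PowerSeries.X) ^ k)⁻¹ = multisetSeries k m := by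
  rw [hsymmInt]
  split_ifs with hm
  · rw [plethysm_hsymm, Int.toNat_of_nonneg hm]
  · ext r
    rw [plethysm, map_zero, map_zero, multisetSeries, PowerSeries.coeff_mk, Nat.card_eq_zero.2,
      Nat.cast_zero]
    exact Or.inl ⟨fun M => hm (by rw [← M.2.1]; positivity)⟩

/-- The Jacobi-Trudi determinant, expanded and evaluated. -/
theorem plethysm_schur :
    plethysm (schur lam) ((1 - PowerSeries.X) ^ k)⁻¹ =
      ∑ s : Equiv.Perm (Fin (Multiset.card lam.parts)),
        ((Equiv.Perm.sign s : ℤ) : PowerSeries ℚ) * ∏ i, multisetSeries k (shifted lam s i) := by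
  rw [schur, plethysm, AlgHom.map_det, ← Matrix.det_transpose, Matrix.det_apply']
  refine sum_congr rfl fun s _ => ?_
  congr 1
  refine prod_congr rfl fun i _ => ?_
  rw [← plethysm_hsymmInt]
  rfl

/-- The scalar product of the Specht character, in its determinantal form, with the character of the
homogeneous polynomials. Burnside's lemma turns each term of the determinant into a count of orbits
on pairs of words, which is a product of plethysms of complete homogeneous functions. -/
theorem finrank_intertwining_eq_coeff :
    (Module.finrank ℂ (IntertwiningMap (spechtRep lam) (homPolyRep r k n)) : ℚ) =
      PowerSeries.coeff r (plethysm (schur lam) ((1 - PowerSeries.X) ^ k)⁻¹) := by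
  have h := sum_character_mul_character (spechtRep lam) (homPolyRep r k n)
  simp only [character_homPolyRep, character_spechtRep] at h
  have h' : ∑ g : Equiv.Perm (Fin n), (fixedCount (HasDegree (k := k) r) g : ℚ) * detChar lam g =
      n.factorial * Module.finrank ℂ (IntertwiningMap (spechtRep lam) (homPolyRep r k n)) := by
    exact_mod_cast h
  have hn : (n.factorial : ℚ) ≠ 0 := Nat.cast_ne_zero.2 (Nat.factorial_ne_zero n)
  apply mul_left_cancel₀ hn
  rw [← h', plethysm_schur, map_sum, mul_sum]
  unfold detChar
  push_cast
  simp only [mul_sum]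
  rw [sum_comm]
  refine sum_congr rfl fun s _ => ?_
  have hB := sum_fixedCount_mul (n := n) (HasContent (shifted lam s)) (HasDegree (k := k) r)
  have hB' := congrArg (Nat.cast : ℕ → ℚ) hB
  rw [Nat.cast_mul, card_multiset_eq_coeff_prod (sum_shifted lam s)] at hB'
  push_cast at hB'
  rw [← zsmul_eq_mul, map_zsmul, zsmul_eq_mul, mul_left_comm, mul_comm (n.factorial : ℚ), ← hB',
    mul_sum]
  exact sum_congr rfl fun g _ => by ring

/-- The two descriptions of the space of equivariant maps agree. -/
def equivariantHomEquiv {G U V : Type*} [Group G] [AddCommGroup U] [Module ℂ U] [AddCommGroup V]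
    [Module ℂ V] (tau : Representation ℂ G U) (rho : Representation ℂ G V) :
    equivariantHom tau rho ≃ₗ[ℂ] IntertwiningMap tau rho where
  toFun f := ⟨f.1, f.2⟩
  map_add' _ _ := rfl
  map_smul' _ _ := rfl
  invFun f := ⟨f.toLinearMap, f.isIntertwining'⟩
  left_inv _ := rfl
  right_inv _ := rfl

end Dimension

/-! ### Simplicity over the centralizer algebra -/

section Simple

variable {n : ℕ} {V : Type*} [AddCommGroup V] [Module ℂ V] [FiniteDimensional ℂ V]
  (rho : Representation ℂ (Equiv.Perm (Fin n)) V) (lam : n.Partition)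

theorem sum_linearMap_comp {ι U W X : Type*} [AddCommGroup U] [Module ℂ U] [AddCommGroup W]
    [Module ℂ W] [AddCommGroup X] [Module ℂ X] (s : Finset ι) (A : ι → W →ₗ[ℂ] X)
    (B : U →ₗ[ℂ] W) : (∑ i ∈ s, A i) ∘ₗ B = ∑ i ∈ s, A i ∘ₗ B := by
  ext x
  simp [LinearMap.sum_apply]

theorem linearMap_comp_sum {ι U W X : Type*} [AddCommGroup U] [Module ℂ U] [AddCommGroup W]
    [Module ℂ W] [AddCommGroup X] [Module ℂ X] (s : Finset ι) (B : W →ₗ[ℂ] X)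
    (A : ι → U →ₗ[ℂ] W) : B ∘ₗ (∑ i ∈ s, A i) = ∑ i ∈ s, B ∘ₗ A i := by
  ext x
  simp [LinearMap.sum_apply]

/-- A nonzero homomorphism out of the Specht module has an equivariant left inverse, obtained by
averaging a linear map `φ` with `tr (φ f) = 1`: the average composed with `f` is a scalar by Schur's
lemma, and the scalar is nonzero because of its trace. -/
theorem exists_left_inverse {f : IntertwiningMap (spechtRep lam) rho} (hf : f ≠ 0) :
    ∃ b : IntertwiningMap rho (spechtRep lam), b.comp f = IntertwiningMap.id (spechtRep lam) := by
  classical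
  obtain ⟨v, hv⟩ : ∃ v, f v ≠ 0 := by
    by_contra! h
    exact hf (IntertwiningMap.ext (LinearMap.ext h))
  obtain ⟨ξ, hξ⟩ := Module.Projective.exists_dual_eq_one ℂ hv
  let φ : V →ₗ[ℂ] Specht lam := ξ.smulRight v
  have htr : LinearMap.trace ℂ _ (φ ∘ₗ f.toLinearMap) = 1 := by
    have : φ ∘ₗ f.toLinearMap = (ξ ∘ₗ f.toLinearMap).smulRight v := rfl
    rw [this, LinearMap.trace_smulRight]
    exact hξ
  let b : IntertwiningMap rho (spechtRep lam) :=
    { toLinearMap := ∑ g : Equiv.Perm (Fin n), spechtRep lam g ∘ₗ φ ∘ₗ rho g⁻¹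
      isIntertwining' := fun h => by
        rw [sum_linearMap_comp, linearMap_comp_sum]
        refine Fintype.sum_equiv (Equiv.mulLeft h⁻¹) _ _ fun g => ?_
        have h1 : spechtRep lam h ∘ₗ spechtRep lam (h⁻¹ * g) = spechtRep lam g := by
          rw [← Module.End.mul_eq_comp, ← map_mul, mul_inv_cancel_left]
        have h2 : rho g⁻¹ ∘ₗ rho h = rho (h⁻¹ * g)⁻¹ := by
          rw [← Module.End.mul_eq_comp, ← map_mul, mul_inv_rev, inv_inv]
        change (spechtRep lam g ∘ₗ φ) ∘ₗ (rho g⁻¹ ∘ₗ rho h) =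
          (spechtRep lam h ∘ₗ spechtRep lam (h⁻¹ * g)) ∘ₗ φ ∘ₗ rho (h⁻¹ * g)⁻¹
        rw [h1, h2]
        rfl }
  obtain ⟨T⟩ : Nonempty (Tableau lam) := inferInstance
  have hid : IntertwiningMap.id (spechtRep lam) ≠ 0 := fun h =>
    spechtGen_ne_zero T (DFunLike.congr_fun h (spechtGen T))
  obtain ⟨c, hc⟩ := (finrank_eq_one_iff_of_nonzero' _ hid).1 (finrank_end_specht lam) (b.comp f)
  have hc0 : c ≠ 0 := by
    rintro rfl
    rw [zero_smul] at hc
    have h1 : b.toLinearMap ∘ₗ f.toLinearMap = 0 := (congrArg (·.toLinearMap) hc).symm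
    have h2 : b.toLinearMap ∘ₗ f.toLinearMap = ∑ g : Equiv.Perm (Fin n),
        spechtRep lam g ∘ₗ (φ ∘ₗ f.toLinearMap) ∘ₗ spechtRep lam g⁻¹ := by
      rw [sum_linearMap_comp]
      refine sum_congr rfl fun g _ => ?_
      rw [LinearMap.comp_assoc, LinearMap.comp_assoc, LinearMap.comp_assoc, f.isIntertwining']
    have h3 := congrArg (LinearMap.trace ℂ _) (h2.symm.trans h1)
    rw [map_sum, map_zero, sum_congr rfl (g := fun _ => (1 : ℂ))] at h3
    · rw [sum_const, card_univ, nsmul_eq_mul, mul_one, Nat.cast_eq_zero] at h3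
      exact Fintype.card_ne_zero h3
    · intro g _
      rw [LinearMap.trace_comp_comm', LinearMap.comp_assoc,
        ← Module.End.mul_eq_comp (spechtRep _ _), ← map_mul, inv_mul_cancel, map_one, ← htr]
      rfl
  refine ⟨c⁻¹ • b, ?_⟩
  rw [IntertwiningMap.smul_comp, ← hc, smul_smul, inv_mul_cancel₀ hc0, one_smul]

/-- A nonzero `g` has an equivariant left inverse `b`, so every `g'` is the image of `g` under the
element `g' ∘ b` of the centralizer algebra: any nonzero element generates the module. -/
theorem isSimpleModule_iff_exists_ne_zero :
    IsSimpleModule (centralizer rho) (equivariantHom (spechtRep lam) rho) ↔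
      ∃ f : IntertwiningMap (spechtRep lam) rho, f ≠ 0 := by
  rw [isSimpleModule_iff_toSpanSingleton_surjective]
  constructor
  · rintro ⟨h, -⟩
    obtain ⟨f, hf⟩ := exists_ne (0 : equivariantHom (spechtRep lam) rho)
    exact ⟨equivariantHomEquiv _ _ f, (LinearEquiv.map_ne_zero_iff _).2 hf⟩
  · rintro ⟨f, hf⟩
    refine ⟨⟨(equivariantHomEquiv _ _).symm f, 0, (LinearEquiv.map_ne_zero_iff _).2 hf⟩,
      fun g hg g' => ?_⟩
    obtain ⟨b, hb⟩ := exists_left_inverse rho lam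
      ((LinearEquiv.map_ne_zero_iff (equivariantHomEquiv _ _)).2 hg)
    refine ⟨⟨g'.1 ∘ₗ b.toLinearMap, (Subalgebra.mem_centralizer_iff ℂ).2 ?_⟩, ?_⟩
    · rintro _ ⟨s, rfl⟩
      rw [Module.End.mul_eq_comp, Module.End.mul_eq_comp, ← LinearMap.comp_assoc, ← g'.2 s,
        LinearMap.comp_assoc, LinearMap.comp_assoc, b.isIntertwining']
    · refine Subtype.ext (LinearMap.ext fun x => ?_)
      change g'.1 (b (g.1 x)) = g'.1 x
      exact congrArg g'.1 (DFunLike.congr_fun hb x)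

end Simple

/-! ### The minimal degree -/

section MinDegree

variable {n k : ℕ}

theorem threshold_succ (k d : ℕ) :
    threshold k (d + 1) = threshold k d + (k + d - 1).choose d := sum_range_succ _ _

theorem threshold_strictMono (hk : 0 < k) : StrictMono (threshold k) :=
  strictMono_nat_of_lt_succ fun d => by
    have : 0 < (k + d - 1).choose d := Nat.choose_pos (by lia)
    rw [threshold_succ]
    lia

/-- The degree of the monomial number `i` (counted from `0`) when the monomials in `k` variables are
listed by increasing degree. -/
def rowDegree (k i : ℕ) : ℕ := Nat.findGreatest (fun d => threshold k d ≤ i) i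

/-- `rowDegree` is the upper adjoint of `threshold`: there are `threshold k d` monomials of degree
less than `d`, by `card_degree_lt`. -/
theorem le_rowDegree_iff (hk : 0 < k) {d i : ℕ} : d ≤ rowDegree k i ↔ threshold k d ≤ i := by
  constructor
  · intro h
    refine ((threshold_strictMono hk).monotone h).trans ?_
    exact Nat.findGreatest_spec (P := fun d => threshold k d ≤ i) (Nat.zero_le i)
      (by simp [threshold])
  · intro h
    exact Nat.le_findGreatest (((threshold_strictMono hk).id_le d).trans h) h

theorem card_degree_eq (k d : ℕ) :
    #(Finsupp.finite_of_degree_eq (σ := Fin k) d).toFinset = (k + d - 1).choose d := by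
  have : (Finsupp.finite_of_degree_eq (σ := Fin k) d).toFinset =
      finsuppAntidiag (univ : Finset (Fin k)) d := by
    ext f
    simp [mem_finsuppAntidiag, Finsupp.degree_eq_sum]
  rw [this, card_finsuppAntidiag_nat_eq_choose, card_univ, Fintype.card_fin]

theorem card_degree_lt (k d : ℕ) :
    #(Finsupp.finite_of_degree_lt (σ := Fin k) d).toFinset = threshold k d := by
  classical
  induction d with
  | zero => simp [threshold]
  | succ d ih =>
    rw [threshold_succ, ← ih, ← card_degree_eq, ← card_union_of_disjoint]
    · congr 1
      ext f
      simp [le_iff_lt_or_eq]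
    · rw [disjoint_left]
      intro f hf hf'
      simp only [Set.Finite.mem_toFinset, Set.mem_ofPred_eq] at hf hf'
      lia

/-- The monomials in `k` variables, listed by increasing degree. -/
theorem exists_monomial_enumeration (hk : 0 < k) :
    ∃ e : ℕ → Fin k →₀ ℕ, Function.Injective e ∧ ∀ i, (e i).degree = rowDegree k i := by
  -- enumerate each degree separately
  have h : ∀ d, ∃ E : ℕ → Fin k →₀ ℕ, ∀ i < (k + d - 1).choose d,
      (E i).degree = d ∧ ∀ j < (k + d - 1).choose d, E i = E j → i = j := fun d => by
    let eq := (equivFinOfCardEq (card_degree_eq k d)).symm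
    refine ⟨fun i => if hi : i < (k + d - 1).choose d then (eq ⟨i, hi⟩).1 else 0, fun i hi => ?_⟩
    simp only [dif_pos hi]
    refine ⟨(Set.Finite.mem_toFinset (Finsupp.finite_of_degree_eq d)).1 (eq ⟨i, hi⟩).2,
      fun j hj hij => ?_⟩
    rw [dif_pos hj] at hij
    exact congrArg Fin.val (eq.injective (Subtype.ext hij))
  choose E hE using h
  have hlt : ∀ i, i - threshold k (rowDegree k i) <
      (k + rowDegree k i - 1).choose (rowDegree k i) := fun i => by
    have h1 : ¬ threshold k (rowDegree k i + 1) ≤ i := fun h => by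
      have := (le_rowDegree_iff hk).2 h
      lia
    have h2 := (le_rowDegree_iff hk).1 (le_refl (rowDegree k i))
    rw [threshold_succ] at h1
    lia
  refine ⟨fun i => E (rowDegree k i) (i - threshold k (rowDegree k i)), fun i j hij => ?_,
    fun i => (hE _ _ (hlt i)).1⟩
  dsimp only at hij
  have hd : rowDegree k i = rowDegree k j := by
    rw [← (hE _ _ (hlt i)).1, hij, (hE _ _ (hlt j)).1]
  have hi := hlt i
  have hi2 := (le_rowDegree_iff hk).1 (le_refl (rowDegree k i))
  have hj2 := (le_rowDegree_iff hk).1 (le_refl (rowDegree k j))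
  rw [hd] at hi hi2 hij
  have := (hE _ _ hi).2 _ (hlt j) hij
  lia

/-- The minimal degree is the degree of the filling of each `i`-th row with the `i`-th monomial. -/
theorem minDegree_eq_sum (hk : 0 < k) {lam : n.Partition} (T : Tableau lam) :
    minDegree k lam = ∑ a, rowDegree k (T.row a) := by
  -- the term of `d` collects the rows filled with monomials of degree `d`
  have hterm : ∀ d, d * ∑ i ∈ Icc (threshold k d + 1) (threshold k (d + 1)), part lam i =
      ∑ a with rowDegree k (T.row a) = d, rowDegree k (T.row a) := by
    intro d
    rw [sum_congr rfl (g := fun _ => d) fun a ha => (mem_filter.1 ha).2, sum_const, smul_eq_mul,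
      mul_comm]
    congr 1
    have hrow : ∀ a, rowDegree k (T.row a) = d ↔
        T.row a + 1 ∈ Icc (threshold k d + 1) (threshold k (d + 1)) := fun a => by
      have h1 := le_rowDegree_iff hk (d := d) (i := T.row a)
      have h2 := le_rowDegree_iff hk (d := d + 1) (i := T.row a)
      rw [mem_Icc]
      lia
    rw [card_eq_sum_card_fiberwise (f := fun a => T.row a + 1)
      (t := Icc (threshold k d + 1) (threshold k (d + 1))) (by
        intro a ha
        exact (hrow a).1 (mem_filter.1 ha).2)]
    refine sum_congr rfl fun i hi => ?_
    obtain ⟨i, rfl⟩ := Nat.exists_eq_succ_of_ne_zero (n := i) (by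
      have := (mem_Icc.1 hi).1
      lia)
    rw [← T.card_row_eq i, filter_filter]
    congr 1
    ext a
    simp only [mem_filter, mem_univ, true_and, hrow]
    constructor
    · rintro h
      subst h
      exact ⟨hi, rfl⟩
    · rintro ⟨-, h⟩
      lia
  rw [minDegree, finsum_congr hterm, finsum_eq_sum_of_support_subset (s := univ.image fun a =>
    rowDegree k (T.row a))]
  · exact sum_fiberwise_of_maps_to (fun a ha => mem_image_of_mem _ ha) _
  · intro d hd
    obtain ⟨a, ha, -⟩ := exists_ne_zero_of_sum_ne_zero hd
    exact mem_coe.2 (mem_image.2 ⟨a, mem_univ _, (mem_filter.1 ha).2⟩)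

/-- If `g` takes small values at most as often as `f` does, then its sum is at least that of `f`. -/
theorem sum_le_sum_of_card_lt_le {f g : Fin n → ℕ}
    (h : ∀ d, #{a | g a < d} ≤ #{a | f a < d}) : ∑ a, f a ≤ ∑ a, g a := by
  have key : ∀ f : Fin n → ℕ, ∀ D, (∀ a, f a ≤ D) →
      ∑ a, f a = ∑ d ∈ range D, #{a | d < f a} := by
    intro f D hD
    simp only [card_filter]
    rw [sum_comm]
    refine sum_congr rfl fun a _ => ?_
    rw [← card_filter]
    have : {d ∈ range D | d < f a} = range (f a) := by
      ext d
      have := hD a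
      simp only [mem_filter, mem_range]
      lia
    rw [this, card_range]
  have hcompl : ∀ (f : Fin n → ℕ) d, #{a | d < f a} + #{a | f a < d + 1} = n := by
    intro f d
    have := card_filter_add_card_filter_not (s := (univ : Finset (Fin n))) (fun a => d < f a)
    rw [card_univ, Fintype.card_fin] at this
    simpa only [not_lt, Nat.lt_succ_iff] using this
  have hle : ∀ (f : Fin n → ℕ) a, f a ≤ ∑ b, f b := fun f a =>
    single_le_sum_of_canonicallyOrdered (f := f) (mem_univ a)
  refine (key f (∑ a, f a + ∑ a, g a) fun a => (hle f a).trans (Nat.le_add_right _ _)).trans_le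
    (le_trans (sum_le_sum fun d _ => ?_)
      (key g (∑ a, f a + ∑ a, g a) fun a => (hle g a).trans (Nat.le_add_left _ _)).ge)
  have h1 := hcompl f d
  have h2 := hcompl g d
  have h3 := h (d + 1)
  lia

/-- The monomials in a column are distinct, so the degree is minimal when the `i`-th row is filled
with the `i`-th monomial. -/
theorem minDegree_le_of_colInjective (hk : 0 < k) {lam : n.Partition} {T : Tableau lam}
    {g : Fin n → Fin k →₀ ℕ} (hg : T.ColInjective g) :
    minDegree k lam ≤ ∑ a, (g a).degree := by
  classical
  rw [minDegree_eq_sum hk T]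
  refine sum_le_sum_of_card_lt_le fun d => ?_
  have h := hg.card_le (Finsupp.finite_of_degree_lt (σ := Fin k) d).toFinset
  rw [card_degree_lt] at h
  simp only [Set.Finite.mem_toFinset, Set.mem_ofPred_eq] at h
  refine h.trans (card_le_card fun a ha => ?_)
  simp only [mem_filter, mem_univ, true_and] at ha ⊢
  by_contra hd
  have := (le_rowDegree_iff hk).1 (not_lt.1 hd)
  lia

end MinDegree

/-! ### Homomorphisms to the homogeneous polynomials -/

section Nonvanishing

variable {n k r : ℕ} {lam : n.Partition}

/-- A nonzero homomorphism maps a polytabloid to a nonzero polynomial, alternating under the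
column permutations. Its monomials are therefore column injective fillings of the tableau by
monomials in `k` variables. -/
theorem minDegree_le_of_ne_zero (hk : 0 < k)
    {f : IntertwiningMap (spechtRep lam) (homPolyRep r k n)} (hf : f ≠ 0) :
    minDegree k lam ≤ r := by
  obtain ⟨T⟩ : Nonempty (Tableau lam) := inferInstance
  have hp : (f (spechtGen T)).1 ≠ 0 := fun h => hf (intertwining_ext T (Subtype.ext h))
  obtain ⟨d, hd⟩ := MvPolynomial.ne_zero_iff.1 hp
  have hhom : (f (spechtGen T)).1.IsHomogeneous r := (f (spechtGen T)).2
  have hdeg : d.degree = r := (DFunLike.congr_fun Finsupp.degree_eq_weight_one d).trans (hhom hd)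
  rw [← hdeg, ← sum_degree_monomialWordEquiv]
  refine minDegree_le_of_colInjective hk (T := T) (Tableau.colInjective_of_alternating
    (v := fun g => MvPolynomial.coeff ((monomialWordEquiv n k).symm g) (f (spechtGen T)).1)
    (fun s hs g => ?_) (by rwa [Equiv.symm_apply_apply]))
  have h1 : MvPolynomial.rename (Prod.map ⇑s id) (f (spechtGen T)).1 =
      ((Equiv.Perm.sign s : ℤ) : ℂ) • (f (spechtGen T)).1 := by
    have h2 : homPolyRep r k n s (f (spechtGen T)) =
        ((Equiv.Perm.sign s : ℤ) : ℂ) • f (spechtGen T) := by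
      rw [← f.isIntertwining, spechtRep_spechtGen_of_colStable T hs, map_smul]
    exact congrArg Subtype.val h2
  have h3 : (monomialWordEquiv n k).symm g =
      ((monomialWordEquiv n k).symm (g ∘ s)).mapDomain (Prod.map ⇑s id) := by
    rw [Equiv.symm_apply_eq, monomialWordEquiv_mapDomain, Equiv.apply_symm_apply]
    funext a
    simp
  have h4 : Function.Injective (Prod.map ⇑s (id : Fin k → Fin k)) :=
    Function.Injective.prodMap s.injective Function.injective_id
  rw [← MvPolynomial.coeff_rename_mapDomain _ h4, ← h3, h1, MvPolynomial.coeff_smul, smul_eq_mul]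

/-- The map sending a tabloid to the monomial `∏_a x_a ^ e(row of a)`. -/
def tabloidToPoly (n : ℕ) (e : ℕ → Fin k →₀ ℕ) :
    ((Fin n → ℕ) →₀ ℂ) →ₗ[ℂ] MvPolynomial (Fin n × Fin k) ℂ :=
  Finsupp.linearCombination ℂ fun g =>
    MvPolynomial.monomial ((monomialWordEquiv n k).symm (e ∘ g)) (1 : ℂ)

theorem rename_tabloidToPoly (e : ℕ → Fin k →₀ ℕ) (s : Equiv.Perm (Fin n))
    (v : (Fin n → ℕ) →₀ ℂ) :
    MvPolynomial.rename (Prod.map ⇑s id) (tabloidToPoly n e v) =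
      tabloidToPoly n e (rowRep n s v) := by
  induction v using Finsupp.induction_linear with
  | zero => simp
  | add v w hv hw => rw [map_add, map_add, hv, hw, map_add, map_add]
  | single g c =>
    rw [← mul_one c, ← smul_eq_mul, ← Finsupp.smul_single, map_smul, map_smul, map_smul, map_smul,
      rowRep_single]
    congr 1
    rw [tabloidToPoly, Finsupp.linearCombination_single, Finsupp.linearCombination_single, one_smul,
      one_smul, MvPolynomial.rename_monomial]
    have h : ((monomialWordEquiv n k).symm (e ∘ g)).mapDomain (Prod.map ⇑s id) =
        (monomialWordEquiv n k).symm (e ∘ g ∘ ⇑s⁻¹) := by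
      rw [Equiv.eq_symm_apply, monomialWordEquiv_mapDomain, Equiv.apply_symm_apply]
      rfl
    rw [h]

/-- Different tabloids go to different monomials. -/
theorem tabloidToPoly_ne_zero {e : ℕ → Fin k →₀ ℕ} (he : Function.Injective e)
    {v : (Fin n → ℕ) →₀ ℂ} (hv : v ≠ 0) : tabloidToPoly n e v ≠ 0 := by
  classical
  obtain ⟨g, hg⟩ := Finsupp.ne_iff.1 hv
  intro h
  apply hg
  have h1 := congrArg (MvPolynomial.coeff ((monomialWordEquiv n k).symm (e ∘ g))) h
  rw [tabloidToPoly, Finsupp.linearCombination_apply, Finsupp.sum, MvPolynomial.coeff_sum,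
    MvPolynomial.coeff_zero] at h1
  rw [Finsupp.zero_apply, ← h1]
  simp only [MvPolynomial.coeff_smul, MvPolynomial.coeff_monomial,
    (monomialWordEquiv n k).symm.injective.eq_iff, he.comp_left.eq_iff, smul_eq_mul, mul_ite,
    mul_one, mul_zero, sum_ite_eq']
  split_ifs with hs
  · rfl
  · exact Finsupp.notMem_support_iff.1 hs

/-- All tabloids of shape `lam` go to monomials of the minimal degree. -/
theorem isHomogeneous_tabloidToPoly {e : ℕ → Fin k →₀ ℕ} (hk : 0 < k)
    (he : ∀ i, (e i).degree = rowDegree k i) (x : Specht lam) :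
    (tabloidToPoly n e x.1).IsHomogeneous (minDegree k lam) := by
  obtain ⟨T⟩ : Nonempty (Tableau lam) := inferInstance
  rw [tabloidToPoly, Finsupp.linearCombination_apply, Finsupp.sum]
  refine MvPolynomial.IsHomogeneous.sum _ _ _ fun g hg => ?_
  have hmon : (MvPolynomial.monomial ((monomialWordEquiv n k).symm (e ∘ g)) (1 : ℂ)).IsHomogeneous
      (minDegree k lam) := by
    refine MvPolynomial.isHomogeneous_monomial _ ?_
    rw [← sum_degree_monomialWordEquiv, Equiv.apply_symm_apply, minDegree_eq_sum hk T]
    simp only [Function.comp_apply, he]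
    have hmap : univ.val.map g = univ.val.map T.row := by
      ext i
      rw [Multiset.count_map, Multiset.count_map]
      have h1 := card_eq_of_mem_specht (Finsupp.mem_support_iff.1 hg) i
      rw [← T.card_row_eq i] at h1
      simp only [eq_comm (a := i)]
      exact h1
    have h2 := congrArg (fun M => (M.map (rowDegree k)).sum) hmap
    simp only [Multiset.map_map] at h2
    exact h2
  rw [MvPolynomial.smul_eq_C_mul]
  simpa using (MvPolynomial.isHomogeneous_C _ (x.1 g)).mul hmon

/-- In the minimal degree `tabloidToPoly` is a nonzero homomorphism; higher degrees are reached by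
multiplying with powers of the invariant `∑_a x_{a,1}`. -/
theorem exists_ne_zero_of_minDegree_le (hn : 0 < n) (hk : 0 < k) (hr : minDegree k lam ≤ r) :
    ∃ f : IntertwiningMap (spechtRep lam) (homPolyRep r k n), f ≠ 0 := by
  obtain ⟨T⟩ : Nonempty (Tableau lam) := inferInstance
  obtain ⟨e, he, hdeg⟩ := exists_monomial_enumeration hk
  let q : MvPolynomial (Fin n × Fin k) ℂ := ∑ a, MvPolynomial.X (a, ⟨0, hk⟩)
  have hq0 : q ≠ 0 := fun h => by
    have := congrArg (MvPolynomial.eval fun _ => (1 : ℂ)) h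
    simp [q] at this
    lia
  have hq1 : (q ^ (r - minDegree k lam)).IsHomogeneous (r - minDegree k lam) := by
    have : q.IsHomogeneous 1 :=
      MvPolynomial.IsHomogeneous.sum _ _ _ fun a _ => MvPolynomial.isHomogeneous_X _ _
    simpa using this.pow (r - minDegree k lam)
  have hqs : ∀ s : Equiv.Perm (Fin n), MvPolynomial.rename (Prod.map ⇑s id) q = q := fun s => by
    simp only [q, map_sum, MvPolynomial.rename_X, Prod.map_apply, id]
    exact Equiv.sum_comp s fun a => MvPolynomial.X (a, (⟨0, hk⟩ : Fin k))
  let f : IntertwiningMap (spechtRep lam) (homPolyRep r k n) :=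
    { toFun := fun x => ⟨tabloidToPoly n e x.1 * q ^ (r - minDegree k lam), by
        have := (isHomogeneous_tabloidToPoly hk hdeg x).mul hq1
        rwa [Nat.add_sub_cancel' hr] at this⟩
      map_add' := fun x y => Subtype.ext (by
        change tabloidToPoly n e (x.1 + y.1) * _ = tabloidToPoly n e x.1 * _ +
          tabloidToPoly n e y.1 * _
        rw [map_add, add_mul])
      map_smul' := fun c x => Subtype.ext (by
        change tabloidToPoly n e (c • x.1) * _ = c • (tabloidToPoly n e x.1 * _)
        rw [map_smul, smul_mul_assoc])
      isIntertwining' := fun s => LinearMap.ext fun x => Subtype.ext (by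
        change tabloidToPoly n e (rowRep n s x.1) * _ =
          MvPolynomial.rename (Prod.map ⇑s id) (tabloidToPoly n e x.1 * _)
        rw [map_mul, map_pow, hqs, rename_tabloidToPoly]) }
  refine ⟨f, fun h => ?_⟩
  have h1 : tabloidToPoly n e (polytabloid T) * q ^ (r - minDegree k lam) = 0 :=
    congrArg Subtype.val (DFunLike.congr_fun h (spechtGen T))
  have h2 : polytabloid T ≠ 0 := fun h => spechtGen_ne_zero T (Subtype.ext h)
  exact mul_ne_zero (tabloidToPoly_ne_zero he h2) (pow_ne_zero _ hq0) h1

end Nonvanishing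

end MultisetPartition

end

theorem mainTheorem3 (n k r : ℕ) (hn : 0 < n) (hk : 0 < k) (hr : 0 < r) (lam : n.Partition) :
    Module.Finite ℂ (MultisetPartition.CentralizerModule r k lam) ∧
    (Module.finrank ℂ (MultisetPartition.CentralizerModule r k lam) : ℚ) =
      PowerSeries.coeff r
        (MultisetPartition.plethysm (MultisetPartition.schur lam)
          ((1 - PowerSeries.X) ^ k)⁻¹) ∧
    (PowerSeries.coeff r
        (MultisetPartition.plethysm (MultisetPartition.schur lam)
          ((1 - PowerSeries.X) ^ k)⁻¹) ≠ 0 ↔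
      MultisetPartition.minDegree k lam ≤ r) ∧
    (IsSimpleModule (MultisetPartition.CentralizerAlgebra r k n)
        (MultisetPartition.CentralizerModule r k lam) ↔
      MultisetPartition.minDegree k lam ≤ r) := by
  have hfin : Module.Finite ℂ (MultisetPartition.CentralizerModule r k lam) := inferInstance
  have hdim : (Module.finrank ℂ (MultisetPartition.CentralizerModule r k lam) : ℚ) =
      PowerSeries.coeff r (MultisetPartition.plethysm (MultisetPartition.schur lam)
        ((1 - PowerSeries.X) ^ k)⁻¹) := by
    rw [(MultisetPartition.equivariantHomEquiv _ _).finrank_eq,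
      MultisetPartition.finrank_intertwining_eq_coeff]
  have hne : (∃ f : Representation.IntertwiningMap (MultisetPartition.spechtRep lam)
      (MultisetPartition.homPolyRep r k n), f ≠ 0) ↔ MultisetPartition.minDegree k lam ≤ r :=
    ⟨fun ⟨_, hf⟩ => MultisetPartition.minDegree_le_of_ne_zero hk hf,
      MultisetPartition.exists_ne_zero_of_minDegree_le hn hk⟩
  have hsimple := MultisetPartition.isSimpleModule_iff_exists_ne_zero
    (MultisetPartition.homPolyRep r k n) lam
  refine ⟨hfin, hdim, ?_, hsimple.trans hne⟩
  have := Module.Finite.equiv (MultisetPartition.equivariantHomEquiv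
    (MultisetPartition.spechtRep lam) (MultisetPartition.homPolyRep r k n))
  rw [← hdim, Nat.cast_ne_zero, ← hne, (MultisetPartition.equivariantHomEquiv _ _).finrank_eq,
    ← pos_iff_ne_zero, Module.finrank_pos_iff, nontrivial_iff_exists_ne 0]
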